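/- Let $\mathbb S=\{z\in\mathbb C:|z|=1\}$, let $V:\mathbb S\to\mathbb R$ be a non-constant $C^3$ function (i.e. $x\mapsto V(e^{ix})$ is $C^3$) with $\int_{\mathbb S}V(w)\,dw=0$, where $dw$ is arc length, and put $W(x)=V(e^{ix})$, $x\in\mathbb R$. Let $\alpha\in(0,2)$. For $(y,s)\in\mathbb R^2$ let $g(y,s,x)=((W(y)-W(y+x))s)_+\mathbf 1_{(-\pi,\pi)}(x)$ and $\|g(y,s,\cdot)\|_1=\int_{-\pi}^{\pi}g(y,s,x)\,dx$. Let $F_{y,s}$ be the distribution function of the law with density $g(y,s,\cdot)/\|g(y,s,\cdot)\|_1$, or of the unit mass at $0$ if $\|g(y,s,\cdot)\|_1=0$, and $F_{y,s}^{-1}(v)=\inf\{x:F_{y,s}(x)\ge v\}$. On a probability space let $X$ be a càdlàg symmetric $\alpha$-stable Lévy process on $\mathbb R$ with $X_0=0$ and $\mathbb E e^{i\xi X_t}=e^{-t|\xi|^\alpha}$, $N$ a Poisson process of intensity $1$ with jump times $\sigma_1<\sigma_2<\dots$ (and $\sigma_0=0$), and $(U_n)_{n\ge1}$ i.i.d.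 uniform on $(0,1)$, with $X$, $N$, $(U_n)$ independent; put $\eta_n(y,s)=F_{y,s}^{-1}(U_n)$. For a starting point $(y,s)$ define $(Y,S)$ recursively: $\tau_0=0$, $S^0(0-)=s$, and, if $\tau_j<\infty$, for $t\ge\tau_j$ $$Y^{j+1}_t=y+X_t+\sum_{n=1}^{j}\eta_n\big(Y^n(\tau_n-),S^n(\tau_n-)\big),\qquad S^{j+1}_t=S^j(\tau_j-)+\int_{\tau_j}^tW(Y^{j+1}_r)\,dr,$$ $$\tau_{j+1}=\inf\Big\{t\ge\tau_j:\ \sigma_j+\int_{\tau_j}^t\|g(Y^{j+1}_r,S^{j+1}_r,\cdot)\|_1\,dr=\sigma_{j+1}\Big\}\quad(\inf\emptyset=\infty),$$ and $(Y_t,S_t)=(Y^{j+1}_t,S^{j+1}_t)$ for $\tau_j\le t<\tau_{j+1}$, $j\ge0$. Let $(\hat Y_t,\hat S_t)=(y+X_t,\ s+\int_0^tW(\hat Y_r)\,dr)$ be the jump-free process. Put $T_tf(y,s)=\mathbb E^{(y,s)}f(Y_t,S_t)$ and $\hat T_tf(y,s)=\mathbb E^{(y,s)}f(\hat Y_t,\hat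 S_t)$. Let $C_*(\mathbb R^2)$ be the set of bounded, uniformly continuous $f:\mathbb R^2\to\mathbb R$ with $\operatorname{supp} f\subset\mathbb R\times[-M,M]$ for some $M>0$, and let $$Rf(y,s)=\int_{y-\pi}^{y+\pi}\big(f(x,s)-f(y,s)\big)\big((W(y)-W(x))s\big)_+\,dx .$$ (1) For every $f\in C_*(\mathbb R^2)$, the limit $\lim_{t\to0^+}(T_tf-f)/t$ exists in $\|\cdot\|_\infty$ if and only if $\lim_{t\to0^+}(\hat T_tf-f)/t$ exists in $\|\cdot\|_\infty$; and if one, hence both, exist, then $$\lim_{t\to0^+}\frac{T_tf-f}{t}=\lim_{t\to0^+}\frac{\hat T_tf-f}{t}+Rf .$$ (2) $R$ is bounded on functions supported in a fixed strip: for every $M$ there is a constant $C$ with $\|Rf\|_\infty\le C\|f\|_\infty$ for all $f\in C_*(\mathbb R^2)$ with $\operatorname{supp}f\subset\mathbb R\times[-M,M]$. (3) Let $\mathcal G$ and $\hat{\mathcal G}$ be the generators, with domains $\mathcal D(\mathcal G)$ and $\mathcal D(\hat{\mathcal G})$, of the transition semigroups of $(e^{iY_t},S_t)$ and $(e^{i\hat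 Y_t},\hat S_t)$ on $C_0(\mathbb S\times\mathbb R)$ (where the process started at $(z,s)$ is obtained by starting the process on $\mathbb R^2$ at $(y,s)$ with $e^{iy}=z$). Then $$\mathcal D(\mathcal G)\cap C_c(\mathbb S\times\mathbb R)=\mathcal D(\hat{\mathcal G})\cap C_c(\mathbb S\times\mathbb R),$$ and for $f$ in this set $\mathcal Gf=\hat{\mathcal G}f+R^{\mathbb S}f$, where $$R^{\mathbb S}f(z,s)=\int_{\mathbb S}\big(f(w,s)-f(z,s)\big)\big((V(z)-V(w))s\big)_+\,dw .$$ -/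

import Mathlib

open MeasureTheory ProbabilityTheory Filter Topology Set
open scoped NNReal ENNReal ZeroAtInfty

noncomputable section

namespace MemoryJump

/-! ### Driving processes -/

/-- Right-continuous paths with left limits. -/
def IsCadlag {E : Type*} [TopologicalSpace E] (x : ℝ≥0 → E) : Prop :=
  ∀ t, ContinuousWithinAt x (Ici t) t ∧ ∃ l, Tendsto x (𝓝[<] t) (𝓝 l)

/-- `X` is a symmetric `α`-stable Lévy process on `ℝ` started at `0`, normalized so that its
generator is `-(-Δ)^{α/2}`, i.e. `𝔼 exp (i ξ (X_t - X_s)) = exp (-(t - s) |ξ|^α)` for `s ≤ t`. -/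
structure IsSymmetricStableProcess {Ω : Type*} [MeasurableSpace Ω] (α : ℝ)
    (X : ℝ≥0 → Ω → ℝ) (P : Measure Ω) : Prop where
  measurable : ∀ t, Measurable (X t)
  start : ∀ᵐ ω ∂P, X 0 ω = 0
  indepIncrements : HasIndepIncrements X P
  charFun_increment : ∀ s t : ℝ≥0, s ≤ t → ∀ ξ : ℝ,
    charFun (P.map (fun ω => X t ω - X s ω)) ξ =
      Complex.exp ((-(((t : ℝ) - (s : ℝ)) * |ξ| ^ α) : ℝ) : ℂ)
  cadlag : ∀ᵐ ω ∂P, IsCadlag (fun t => X t ω)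

/-- `N` is a Poisson process with intensity `1`. -/
structure IsPoissonProcess {Ω : Type*} [MeasurableSpace Ω]
    (N : ℝ≥0 → Ω → ℕ) (P : Measure Ω) : Prop where
  measurable : ∀ t, Measurable (N t)
  start : ∀ᵐ ω ∂P, N 0 ω = 0
  indepIncrements : HasIndepIncrements N P
  law_increment : ∀ s t : ℝ≥0, s ≤ t →
    P.map (fun ω => N t ω - N s ω) = poissonMeasure (t - s)
  monotone : ∀ᵐ ω ∂P, Monotone (fun t => N t ω)
  cadlag : ∀ᵐ ω ∂P, IsCadlag (fun t => N t ω)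

/-- `U` is a sequence of independent random variables, uniformly distributed on `(0,1)`. -/
structure IsUniformSequence {Ω : Type*} [MeasurableSpace Ω]
    (U : ℕ → Ω → ℝ) (P : Measure Ω) : Prop where
  measurable : ∀ n, Measurable (U n)
  indep : iIndepFun U P
  law : ∀ n, P.map (U n) = (volume : Measure ℝ).restrict (Ioo 0 1)

/-- The process families `X`, `N`, `U` are (mutually) independent: `X` is independent of `N`, and
the pair `(X, N)` is independent of `U`. -/
def IndependentDrivers {Ω : Type*} [MeasurableSpace Ω] (X : ℝ≥0 → Ω → ℝ) (N : ℝ≥0 → Ω → ℕ)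
    (U : ℕ → Ω → ℝ) (P : Measure Ω) : Prop :=
  IndepFun (fun ω t => X t ω) (fun ω t => N t ω) P ∧
  IndepFun (fun ω => ((fun t => X t ω), (fun t => N t ω))) (fun ω n => U n ω) P

/-- The time of the `k`-th jump of a unit-jump counting path `n` started at `0`. -/
def jumpTime (n : ℝ≥0 → ℕ) (k : ℕ) : ℝ≥0 := sInf {t | k ≤ n t}

/-! ### The jump density -/

/-- `g(y,s,x) = ((W(y) - W(y+x)) s)₊ 1_{(-π,π)}(x)`. -/
def g (W : ℝ → ℝ) (y s x : ℝ) : ℝ :=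
  (Ioo (-Real.pi) Real.pi).indicator (fun x => max ((W y - W (y + x)) * s) 0) x

/-- `‖g(y,s,·)‖₁`. -/
def gNorm (W : ℝ → ℝ) (y s : ℝ) : ℝ := ∫ x in (-Real.pi)..Real.pi, g W y s x

open Classical in
/-- The distribution function `F_{y,s}` of the law with density `g(y,s,·)/‖g(y,s,·)‖₁`, or of the
unit mass at `0` if `‖g(y,s,·)‖₁ = 0`. -/
def jumpCDF (W : ℝ → ℝ) (y s x : ℝ) : ℝ :=
  if gNorm W y s = 0 then (if 0 ≤ x then 1 else 0)
  else ∫ z in Iic x, g W y s z / gNorm W y s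

/-- `F_{y,s}^{-1}(v)`. -/
def jumpQuantile (W : ℝ → ℝ) (y s v : ℝ) : ℝ := sInf {x | v ≤ jumpCDF W y s x}

/-! ### The pathwise construction of `(Y, S)`

Throughout, `x` is a path of `X`, `σ k` is the `k`-th jump time of the Poisson path (with
`σ 0 = 0`), `u` is a sequence of values of the uniform variables (`u j` is used for the jump
number `j + 1`), and `(y, s)` is the starting point. -/

/-- The data available after `j` jumps: the jump time `τ_j ∈ [0,∞]` (with `τ_0 = 0`), the sum of
the first `j` jumps, and the value of `S` at time `τ_j`. -/
structure Stage where
  time : ℝ≥0∞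
  jumps : ℝ
  memory : ℝ

/-- `Y^{j+1}_t = y + X_t + ∑_{n ≤ j} η_n`. -/
def stageY (x : ℝ≥0 → ℝ) (y : ℝ) (p : Stage) (t : ℝ≥0) : ℝ := y + x t + p.jumps

/-- `S^{j+1}_t = S(τ_j) + ∫_{τ_j}^t W(Y^{j+1}_r) dr`. -/
def stageS (W : ℝ → ℝ) (x : ℝ≥0 → ℝ) (y : ℝ) (p : Stage) (t : ℝ≥0) : ℝ :=
  p.memory + ∫ r in p.time.toReal..(t : ℝ), W (stageY x y p r.toNNReal)

/-- The clock `σ_j + ∫_{τ_j}^t ‖g(Y^{j+1}_r, S^{j+1}_r, ·)‖₁ dr`; here `a = σ_j`. -/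
def stageClock (W : ℝ → ℝ) (x : ℝ≥0 → ℝ) (y : ℝ) (p : Stage) (a : ℝ≥0) (t : ℝ≥0) : ℝ :=
  a + ∫ r in p.time.toReal..(t : ℝ),
    gNorm W (stageY x y p r.toNNReal) (stageS W x y p r.toNNReal)

/-- `τ_{j+1}`, the first time `t ≥ τ_j` at which the clock, started from `a = σ_j` at time `τ_j`,
equals `b = σ_{j+1}`; it is `∞` if there is none, in particular if `τ_j = ∞`. -/
def stageEnd (W : ℝ → ℝ) (x : ℝ≥0 → ℝ) (y : ℝ) (p : Stage) (a b : ℝ≥0) : ℝ≥0∞ :=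
  sInf {T | ∃ t : ℝ≥0, T = t ∧ p.time ≤ t ∧ stageClock W x y p a t = b}

/-- Passing from `j` to `j + 1` jumps: at time `τ_{j+1}` the jump
`η_{j+1}(Y^{j+1}(τ_{j+1}-), S^{j+1}(τ_{j+1}-))` is added. -/
def nextStage (W : ℝ → ℝ) (x : ℝ≥0 → ℝ) (y : ℝ) (p : Stage) (a b : ℝ≥0) (v : ℝ) : Stage :=
  let τ : ℝ≥0∞ := stageEnd W x y p a b
  let yLeft : ℝ := Function.leftLim (stageY x y p) τ.toNNReal
  let sLeft : ℝ := Function.leftLim (stageS W x y p) τ.toNNReal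
  { time := τ
    jumps := p.jumps + jumpQuantile W yLeft sLeft v
    memory := sLeft }

/-- The data after `j` jumps. -/
def stage (W : ℝ → ℝ) (x : ℝ≥0 → ℝ) (σ : ℕ → ℝ≥0) (u : ℕ → ℝ) (y s : ℝ) : ℕ → Stage
  | 0 => { time := 0, jumps := 0, memory := s }
  | j + 1 => nextStage W x y (stage W x σ u y s j) (σ j) (σ (j + 1)) (u j)

/-- The index `j` with `τ_j ≤ t < τ_{j+1}` (the number of jumps up to time `t`). -/
def stageIndex (W : ℝ → ℝ) (x : ℝ≥0 → ℝ) (σ : ℕ → ℝ≥0) (u : ℕ → ℝ) (y s : ℝ) (t : ℝ≥0) : ℕ :=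
  sInf {j | (stage W x σ u y s j).time ≤ t ∧ (t : ℝ≥0∞) < (stage W x σ u y s (j + 1)).time}

/-- The path `(Y_t, S_t)`, equal to `(Y^{j+1}_t, S^{j+1}_t)` for `τ_j ≤ t < τ_{j+1}`. -/
def pathYS (W : ℝ → ℝ) (x : ℝ≥0 → ℝ) (σ : ℕ → ℝ≥0) (u : ℕ → ℝ) (q : ℝ × ℝ) (t : ℝ≥0) : ℝ × ℝ :=
  let p : Stage := stage W x σ u q.1 q.2 (stageIndex W x σ u q.1 q.2 t)
  (stageY x q.1 p t, stageS W x q.1 p t)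

/-- The jump-free path `(Ŷ_t, Ŝ_t) = (y + X_t, s + ∫_0^t W(Ŷ_r) dr)`. -/
def pathHat (W : ℝ → ℝ) (x : ℝ≥0 → ℝ) (q : ℝ × ℝ) (t : ℝ≥0) : ℝ × ℝ :=
  (q.1 + x t, q.2 + ∫ r in (0 : ℝ)..(t : ℝ), W (q.1 + x r.toNNReal))

/-! ### Semigroups on `ℝ²` and on `𝕊 × ℝ` -/

section Semigroups

variable {Ω : Type*} [MeasurableSpace Ω]

/-- The process `(Y_t, S_t)` started at `q`. -/
def processYS (W : ℝ → ℝ) (X : ℝ≥0 → Ω → ℝ) (N : ℝ≥0 → Ω → ℕ) (U : ℕ → Ω → ℝ)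
    (q : ℝ × ℝ) (t : ℝ≥0) (ω : Ω) : ℝ × ℝ :=
  pathYS W (fun r => X r ω) (jumpTime (fun r => N r ω)) (fun n => U n ω) q t

/-- The process `(Ŷ_t, Ŝ_t)` started at `q`. -/
def processHat (W : ℝ → ℝ) (X : ℝ≥0 → Ω → ℝ) (q : ℝ × ℝ) (t : ℝ≥0) (ω : Ω) : ℝ × ℝ :=
  pathHat W (fun r => X r ω) q t

/-- `T_t f(y,s) = 𝔼^{(y,s)} f(Y_t, S_t)`. -/
def semigroupYS (P : Measure Ω) (W : ℝ → ℝ) (X : ℝ≥0 → Ω → ℝ) (N : ℝ≥0 → Ω → ℕ)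
    (U : ℕ → Ω → ℝ) (t : ℝ≥0) (f : ℝ × ℝ → ℝ) (q : ℝ × ℝ) : ℝ :=
  ∫ ω, f (processYS W X N U q t ω) ∂P

/-- `T̂_t f(y,s) = 𝔼^{(y,s)} f(Ŷ_t, Ŝ_t)`. -/
def semigroupHat (P : Measure Ω) (W : ℝ → ℝ) (X : ℝ≥0 → Ω → ℝ)
    (t : ℝ≥0) (f : ℝ × ℝ → ℝ) (q : ℝ × ℝ) : ℝ :=
  ∫ ω, f (processHat W X q t ω) ∂P

/-- The covering map `(y,s) ↦ (e^{iy}, s)`. -/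
def wrap (q : ℝ × ℝ) : Circle × ℝ := (Circle.exp q.1, q.2)

/-- The preimage `(Arg z, s)` of `(z,s)` under `wrap`. -/
def unwrap (p : Circle × ℝ) : ℝ × ℝ := (Complex.arg (p.1 : ℂ), p.2)

/-- `T_t^𝕊 f(z,s) = 𝔼^{(z,s)} f(Z_t, S_t)` with `Z_t = e^{iY_t}`; the process started at `(z,s)` is
obtained by starting `(Y,S)` at `(y,s)` with `e^{iy} = z`. As `W` is `2π`-periodic, all choices of
`y` give the same law; we take `y = Arg z`. -/
def semigroupZS (P : Measure Ω) (W : ℝ → ℝ) (X : ℝ≥0 → Ω → ℝ) (N : ℝ≥0 → Ω → ℕ)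
    (U : ℕ → Ω → ℝ) (t : ℝ≥0) (f : Circle × ℝ → ℝ) (p : Circle × ℝ) : ℝ :=
  ∫ ω, f (wrap (processYS W X N U (unwrap p) t ω)) ∂P

/-- `T̂_t^𝕊 f(z,s) = 𝔼^{(z,s)} f(Ẑ_t, Ŝ_t)` with `Ẑ_t = e^{iŶ_t}`. -/
def semigroupZHat (P : Measure Ω) (W : ℝ → ℝ) (X : ℝ≥0 → Ω → ℝ)
    (t : ℝ≥0) (f : Circle × ℝ → ℝ) (p : Circle × ℝ) : ℝ :=
  ∫ ω, f (wrap (processHat W X (unwrap p) t ω)) ∂P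

end Semigroups

/-! ### Function spaces, generators, jump operators -/

/-- `C_*(ℝ²)`: bounded uniformly continuous functions with support in `ℝ × [-M, M]` for some
`M > 0`. -/
structure IsCStar (f : ℝ × ℝ → ℝ) : Prop where
  bounded : ∃ B : ℝ, ∀ q, |f q| ≤ B
  uniformContinuous : UniformContinuous f
  support : ∃ M : ℝ, 0 < M ∧ Function.support f ⊆ {q | |q.2| ≤ M}

/-- `lim_{t → 0+} (T_t f - f)/t = L` in the supremum norm. -/
def IsGenLimit {E : Type*} (T : ℝ≥0 → (E → ℝ) → E → ℝ) (f L : E → ℝ) : Prop :=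
  TendstoUniformly (fun (t : ℝ≥0) q => (T t f q - f q) / (t : ℝ)) L (𝓝[>] 0)

theorem IsGenLimit.unique {E : Type*} {T : ℝ≥0 → (E → ℝ) → E → ℝ} {f L L' : E → ℝ}
    (h : IsGenLimit T f L) (h' : IsGenLimit T f L') : L = L' :=
  funext fun q => tendsto_nhds_unique (h.tendsto_at q) (h'.tendsto_at q)

/-- The domain of the generator of the semigroup `T` on `C₀(E)`. -/
def genDomain {E : Type*} [TopologicalSpace E] (T : ℝ≥0 → (E → ℝ) → E → ℝ) : Set C₀(E, ℝ) :=
  {f | ∃ L : C₀(E, ℝ), IsGenLimit T f L}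

/-- The generator of the semigroup `T` on `C₀(E)`. -/
def generator {E : Type*} [TopologicalSpace E] (T : ℝ≥0 → (E → ℝ) → E → ℝ) (f : C₀(E, ℝ))
    (hf : f ∈ genDomain T) : C₀(E, ℝ) := Classical.choose hf

theorem generator_spec {E : Type*} [TopologicalSpace E] {T : ℝ≥0 → (E → ℝ) → E → ℝ}
    {f : C₀(E, ℝ)} (hf : f ∈ genDomain T) : IsGenLimit T f (generator T f hf) :=
  Classical.choose_spec hf

/-- `C_c(E)` as a subset of `C₀(E)`. -/
def CcSet (E : Type*) [TopologicalSpace E] : Set C₀(E, ℝ) :=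
  {f | HasCompactSupport f}

/-- `Rf(y,s) = ∫_{y-π}^{y+π} (f(x,s) - f(y,s)) ((W(y) - W(x)) s)₊ dx`. -/
def jumpOp (W : ℝ → ℝ) (f : ℝ × ℝ → ℝ) (q : ℝ × ℝ) : ℝ :=
  ∫ x in (-Real.pi + q.1)..(Real.pi + q.1),
    (f (x, q.2) - f q) * max ((W q.1 - W x) * q.2) 0

/-- The integral over the unit circle with respect to arc length (total mass `2π`). -/
def arcIntegral (F : Circle → ℝ) : ℝ := ∫ θ in (-Real.pi)..Real.pi, F (Circle.exp θ)

/-- `R^𝕊 f(z,s) = ∫_𝕊 (f(w,s) - f(z,s)) ((V(z) - V(w)) s)₊ dw`. -/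
def jumpOpCircle (V : Circle → ℝ) (f : Circle × ℝ → ℝ) (p : Circle × ℝ) : ℝ :=
  arcIntegral (fun w => (f (w, p.2) - f p) * max ((V p.1 - V w) * p.2) 0)

/-- `W(x) = V(e^{ix})`. -/
def lift (V : Circle → ℝ) (x : ℝ) : ℝ := V (Circle.exp x)

end MemoryJump

end

noncomputable section

namespace MemoryJump

/-! ### Càdlàg paths -/

section Cadlag

variable {Ω : Type*} [MeasurableSpace Ω]

/-! Everything reduces to one fact: for `f` in C_* the quotient (T_t f − T̂_t f)/t tends to Rf
uniformly (`RegularDrivers.tendstoUniformly`). The difference quotients of the two semigroups then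
differ by a uniformly convergent family, so one converges if and only if the other does, and the
limits differ by Rf.

Run both processes from (y,s) with the same path of X; they agree until the first jump. S moves at
speed at most K, a bound for |W|, so for small t it stays in a strip |S| ≤ m, where the clock runs
at speed at most Λ = 4πKm. A jump by time t therefore forces σ₁ ≤ Λt, and a second one forces σ₂ ≤
Λt, an event of probability O(t²) (`le_of_second_jump`). That X leaves the δ-ball and also σ₁ ≤ Λt
has, by independence of X and N, probability at most a small number times Λt
(`RegularDrivers.badEvent_le`). In the remaining one-jump case uniform continuity replaces the
difference of the values of f by f(y+η,s) − f(y,s) (`RegularDrivers.abs_integral_path_sub_le`).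

With G = ‖g(y,s,·)‖₁, the first jump occurs by time t with probability Gt + o(t)
(`RegularDrivers.jumpEvent_prob`), and averaging over the independent uniform variable integrates
against the density g/G at the position just before the jump. The factor G cancels and t·Rf remains.
Since g/G need not be continuous where G vanishes, the estimate is made for G times the mean, and
small G is treated separately (`RegularDrivers.abs_integral_firstJump_sub_le`).

Uniformity holds because starting points far outside the strip of f contribute exactly zero, and
inside it all constants depend on the strip only. On the circle, f ∘ `wrap` lies in C_* for
compactly supported f, and periodicity turns R into R^𝕊. -/

theorem tendsto_ceil_mul_div_nnreal (r : ℝ≥0) :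
    Tendsto (fun n : ℕ => (⌈r * (n + 1)⌉₊ : ℝ≥0) / (n + 1)) atTop (𝓝[≥] r) := by
  have hlow : ∀ n : ℕ, r ≤ (⌈r * (n + 1)⌉₊ : ℝ≥0) / (n + 1) := fun n => by
    rw [le_div_iff₀ (by positivity)]
    exact Nat.le_ceil _
  refine tendsto_nhdsWithin_iff.2 ⟨?_, Eventually.of_forall hlow⟩
  have hup : ∀ n : ℕ, (⌈r * (n + 1)⌉₊ : ℝ≥0) / (n + 1) ≤ r + 1 / ((n : ℝ≥0) + 1) := fun n => by
    rw [div_le_iff₀ (by positivity), add_mul, one_div_mul_cancel (by positivity)]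
    have hn : 0 ≤ r * ((n : ℝ≥0) + 1) := zero_le
    have h := (Nat.ceil_lt_add_one hn).le
    exact h
  have hlim : Tendsto (fun n : ℕ => r + 1 / ((n : ℝ≥0) + 1)) atTop (𝓝 r) := by
    simpa using tendsto_const_nhds.add (tendsto_one_div_add_atTop_nhds_zero_nat (𝕜 := ℝ≥0))
  exact tendsto_of_tendsto_of_tendsto_of_le_of_le tendsto_const_nhds hlim hlow hup

/-- A process with right-continuous paths is jointly measurable. -/
theorem measurable_uncurry_of_cadlag {X : ℝ≥0 → Ω → ℝ} (hX : ∀ t, Measurable (X t))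
    (hc : ∀ ω, IsCadlag (fun t => X t ω)) : Measurable (fun p : ℝ≥0 × Ω => X p.1 p.2) := by
  -- By right-continuity X_r is the limit of the values at grid points approaching r from the right.
  -- For fixed `n` the grid is countable, so only the measurability of each X_t is needed.
  obtain ⟨d, hd, hlim⟩ : ∃ d : ℕ → ℝ≥0 → ℕ, (∀ n, Measurable (d n)) ∧
      ∀ r, Tendsto (fun n : ℕ => (d n r : ℝ≥0) / (n + 1)) atTop (𝓝[≥] r) :=
    ⟨fun n r => ⌈r * (n + 1)⌉₊, fun n => Nat.measurable_ceil.comp (measurable_id.mul_const _),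
      tendsto_ceil_mul_div_nnreal⟩
  refine measurable_of_tendsto_metrizable
    (f := fun (n : ℕ) (p : ℝ≥0 × Ω) => X ((d n p.1 : ℝ≥0) / (n + 1)) p.2)
    (fun n => ?_) (tendsto_pi_nhds.2 fun p => ?_)
  · have h : Measurable (fun q : ℕ × Ω => X ((q.1 : ℝ≥0) / (n + 1)) q.2) :=
      measurable_from_prod_countable_right fun k => hX ((k : ℝ≥0) / (n + 1))
    exact h.comp (((hd n).comp measurable_fst).prodMk measurable_snd)
  · exact Tendsto.comp (g := fun t => X t p.2) (hc p.2 p.1).1.tendsto (hlim p.1)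

theorem IsCadlag.measurable {x : ℝ≥0 → ℝ} (hx : IsCadlag x) : Measurable x :=
  (measurable_uncurry_of_cadlag (Ω := Unit) (X := fun t _ => x t) (fun _ => measurable_const)
    (fun _ => hx)).comp (measurable_id.prodMk (measurable_const (a := ())))

/-- The approximating times depend measurably on `t`, so left limits at random times become limits
of measurable functions. At `t = 0` the left limit is by convention the value itself, and the
sequence is constant. -/
theorem tendsto_leftLim_seq {x : ℝ≥0 → ℝ} {t : ℝ≥0} (h : ∃ l, Tendsto x (𝓝[<] t) (𝓝 l)) :
    Tendsto (fun n : ℕ => x (t * (n / (n + 1)))) atTop (𝓝 (Function.leftLim x t)) := by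
  rcases eq_or_ne t 0 with rfl | ht
  · rw [leftLim_eq_of_isBot (fun _ => zero_le)]
    simp
  · refine (tendsto_leftLim_of_tendsto h).comp (tendsto_nhdsWithin_iff.2 ⟨?_, ?_⟩)
    · have : Tendsto (fun n : ℕ => (n : ℝ≥0) / (n + 1)) atTop (𝓝 1) := by
        rw [← NNReal.tendsto_coe]
        simpa using tendsto_natCast_div_add_atTop (1 : ℝ)
      simpa using this.const_mul t
    · refine Eventually.of_forall fun n => ?_
      have h1 : (n : ℝ≥0) / (n + 1) < 1 := by
        rw [div_lt_one (by positivity)]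
        exact lt_add_one _
      calc t * (n / (n + 1)) < t * 1 := by gcongr
        _ = t := mul_one t

/-- A bound that holds up to time `t` holds for the left limit at `t`. -/
theorem abs_leftLim_sub_le {x : ℝ≥0 → ℝ} {t : ℝ≥0} (h : ∃ l, Tendsto x (𝓝[<] t) (𝓝 l))
    {a c : ℝ} (hb : ∀ r ≤ t, |x r - a| ≤ c) : |Function.leftLim x t - a| ≤ c := by
  refine le_of_tendsto ((tendsto_leftLim_seq h).sub_const a).abs (Eventually.of_forall fun n => ?_)
  refine hb _ (mul_le_of_le_one_right zero_le ?_)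
  rw [div_le_one (by positivity)]
  exact le_self_add

theorem measurable_leftLim {Z : Ω → ℝ≥0 → ℝ} (hZ : Measurable (fun p : ℝ≥0 × Ω => Z p.2 p.1))
    (hl : ∀ ω t, ∃ l, Tendsto (Z ω) (𝓝[<] t) (𝓝 l)) {τ : Ω → ℝ≥0} (hτ : Measurable τ) :
    Measurable (fun ω => Function.leftLim (Z ω) (τ ω)) := by
  refine measurable_of_tendsto_metrizable
    (f := fun (n : ℕ) ω => Z ω (τ ω * (n / (n + 1)))) (fun n => ?_)
    (tendsto_pi_nhds.2 fun ω => tendsto_leftLim_seq (hl ω (τ ω)))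
  have hm : Measurable (fun ω => τ ω * ((n : ℝ≥0) / (n + 1))) := hτ.mul_const _
  exact hZ.comp (hm.prodMk measurable_id)

/-- Joint in the endpoints as well as in ω, because the integrals of the construction start at
random jump times. Putting the endpoints into an indicator reduces this to the measurability of
parametric integrals. -/
theorem measurable_intervalIntegral {h : ℝ → Ω → ℝ} (hh : Measurable (fun p : ℝ × Ω => h p.1 p.2)) :
    Measurable (fun p : (ℝ × ℝ) × Ω => ∫ r in p.1.1..p.1.2, h r p.2) := by
  have key : Measurable (fun p : (ℝ × ℝ) × Ω => ∫ r in Ioc p.1.1 p.1.2, h r p.2) := by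
    have hs : MeasurableSet {p : ((ℝ × ℝ) × Ω) × ℝ | p.1.1.1 < p.2 ∧ p.2 ≤ p.1.1.2} :=
      MeasurableSet.inter
        (measurableSet_lt (by fun_prop : Measurable fun p : ((ℝ × ℝ) × Ω) × ℝ => p.1.1.1)
          measurable_snd)
        (measurableSet_le measurable_snd
          (by fun_prop : Measurable fun p : ((ℝ × ℝ) × Ω) × ℝ => p.1.1.2))
    have hm : Measurable (fun p : ((ℝ × ℝ) × Ω) × ℝ =>
        {p : ((ℝ × ℝ) × Ω) × ℝ | p.1.1.1 < p.2 ∧ p.2 ≤ p.1.1.2}.indicator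
          (fun p => h p.2 p.1.2) p) :=
      Measurable.indicator (hh.comp (measurable_snd.prodMk (measurable_snd.comp measurable_fst))) hs
    have := (hm.stronglyMeasurable.integral_prod_right' (ν := (volume : Measure ℝ))).measurable
    convert! this using 2 with p
    rw [← integral_indicator measurableSet_Ioc]
    rfl
  have swap : Measurable (fun p : (ℝ × ℝ) × Ω => ((p.1.2, p.1.1), p.2)) := by fun_prop
  have h := key.sub (key.comp swap)
  exact h

end Cadlag

/-! ### Quantiles -/

section Quantile

variable (μ : Measure ℝ)

/-- Right-continuity of the distribution function makes the infimum attained; `v > 0` bounds the set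
below and `v < 1` makes it nonempty. -/
theorem sInf_le_iff_le_cdf {v : ℝ} (hv : v ∈ Ioo (0 : ℝ) 1) (c : ℝ) :
    sInf {x | v ≤ cdf μ x} ≤ c ↔ v ≤ cdf μ c := by
  have hbdd : BddBelow {x | v ≤ cdf μ x} := by
    obtain ⟨a, ha⟩ := ((tendsto_cdf_atBot μ).eventually_lt_const hv.1).exists
    refine ⟨a, fun x hx => ?_⟩
    by_contra! hlt
    exact absurd (hx.trans (monotone_cdf μ hlt.le)) (not_le.2 ha)
  have hne : {x | v ≤ cdf μ x}.Nonempty := by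
    obtain ⟨b, hb⟩ := ((tendsto_cdf_atTop μ).eventually_const_lt hv.2).exists
    exact ⟨b, hb.le⟩
  refine ⟨fun h => ?_, fun h => csInf_le hbdd h⟩
  have hgt : ∀ x, c < x → v ≤ cdf μ x := fun x hx => by
    obtain ⟨z, hz, hzx⟩ := exists_lt_of_csInf_lt hne (h.trans_lt hx)
    exact le_trans hz (monotone_cdf μ hzx.le)
  have hc := ((cdf μ).right_continuous c).mono Ioi_subset_Ici_self
  exact ge_of_tendsto hc (by filter_upwards [self_mem_nhdsWithin] with x hx using hgt x hx)

/-- Outside (0,1) the real infimum may take its default value, so the function is cut off there,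
which is invisible to the restricted measure. -/
theorem measurable_sInf_cdf_on :
    AEMeasurable (fun v => sInf {x | v ≤ cdf μ x}) ((volume : Measure ℝ).restrict (Ioo 0 1)) := by
  refine ⟨(Ioo (0 : ℝ) 1).indicator fun v => sInf {x | v ≤ cdf μ x}, ?_, ?_⟩
  · refine measurable_of_Iic fun c => ?_
    have : (Ioo (0 : ℝ) 1).indicator (fun v => sInf {x | v ≤ cdf μ x}) ⁻¹' Iic c =
        (Ioo 0 1 ∩ Iic (cdf μ c)) ∪ ((Ioo 0 1)ᶜ ∩ {_v | 0 ≤ c}) := by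
      ext v
      by_cases hv : v ∈ Ioo (0 : ℝ) 1
      · simp [hv, sInf_le_iff_le_cdf μ hv]
      · simp [hv]
    rw [this]
    exact (measurableSet_Ioo.inter measurableSet_Iic).union
      (measurableSet_Ioo.compl.inter (MeasurableSet.const _))
  · filter_upwards [ae_restrict_mem measurableSet_Ioo] with v hv
    simp [hv]

/-- The quantile function maps the uniform law to `μ`. -/
theorem map_sInf_cdf [IsProbabilityMeasure μ] :
    ((volume : Measure ℝ).restrict (Ioo 0 1)).map (fun v => sInf {x | v ≤ cdf μ x}) = μ := by
  have : IsFiniteMeasure ((volume : Measure ℝ).restrict (Ioo (0 : ℝ) 1)) := ⟨by simp⟩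
  refine Measure.ext_of_Iic _ _ fun c => ?_
  rw [Measure.map_apply_of_aemeasurable (measurable_sInf_cdf_on μ) measurableSet_Iic]
  have h1 : (fun v => sInf {x | v ≤ cdf μ x}) ⁻¹' Iic c
      =ᵐ[(volume : Measure ℝ).restrict (Ioo 0 1)] Iic (cdf μ c) := by
    filter_upwards [ae_restrict_mem measurableSet_Ioo] with v hv
    exact propext (sInf_le_iff_le_cdf μ hv c)
  rw [measure_congr h1, Measure.restrict_apply measurableSet_Iic, ← ofReal_cdf μ c]
  refine le_antisymm ?_ ?_
  -- The set lies between the open and the half-open interval from 0 to `cdf μ c`; both have length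
  -- `cdf μ c`.
  · refine (measure_mono (t := Ioc 0 (cdf μ c)) fun v hv => ⟨hv.2.1, hv.1⟩).trans ?_
    simp
  · refine le_trans ?_ (measure_mono (s := Ioo 0 (cdf μ c))
      fun v hv => ⟨hv.2.le, hv.1, hv.2.trans_le (cdf_le_one μ c)⟩)
    simp

end Quantile

/-! ### The jump density and the law of a jump -/

section Density

variable {W : ℝ → ℝ}

theorem g_nonneg (y s x : ℝ) : 0 ≤ g W y s x :=
  indicator_nonneg (fun _ _ => le_max_right _ _) x

theorem measurable_g (hW : Continuous W) :
    Measurable (fun p : (ℝ × ℝ) × ℝ => g W p.1.1 p.1.2 p.2) := by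
  have h : Measurable (fun p : (ℝ × ℝ) × ℝ => max ((W p.1.1 - W (p.1.1 + p.2)) * p.1.2) 0) := by
    fun_prop
  exact h.indicator (measurable_snd (measurableSet_Ioo (a := -Real.pi) (b := Real.pi)))

/-- The cut-off in `g` moves into the domain of integration and leaves a density that is continuous
when `W` is; continuity estimates are made in this form. -/
theorem integral_mul_g (h : ℝ → ℝ) (y s : ℝ) :
    ∫ x, h x * g W y s x =
      ∫ x in (-Real.pi)..Real.pi, h x * max ((W y - W (y + x)) * s) 0 := by
  rw [intervalIntegral.integral_of_le (by linarith [Real.pi_pos]), integral_Ioc_eq_integral_Ioo,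
    ← integral_indicator measurableSet_Ioo]
  refine integral_congr_ae (Eventually.of_forall fun x => ?_)
  by_cases hx : x ∈ Ioo (-Real.pi) Real.pi <;> simp [g, hx]

theorem integrable_g (hW : Continuous W) (y s : ℝ) : Integrable (g W y s) := by
  refine (integrable_indicator_iff measurableSet_Ioo).2 ?_
  have h : Continuous (fun x => max ((W y - W (y + x)) * s) 0) := by fun_prop
  exact (h.continuousOn.integrableOn_Icc (a := -Real.pi) (b := Real.pi)).mono_set Ioo_subset_Icc_self

theorem gNorm_eq (y s : ℝ) :
    gNorm W y s = ∫ x in (-Real.pi)..Real.pi, max ((W y - W (y + x)) * s) 0 := by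
  have h := integral_mul_g (W := W) (fun _ => 1) y s
  simp only [one_mul] at h
  rw [← h, gNorm, intervalIntegral.integral_of_le (by linarith [Real.pi_pos]),
    ← integral_indicator measurableSet_Ioc]
  refine integral_congr_ae (Eventually.of_forall fun x => ?_)
  by_cases hx : x ∈ Ioc (-Real.pi) Real.pi
  · simp [hx]
  · have : x ∉ Ioo (-Real.pi) Real.pi := fun hx' => hx ⟨hx'.1, hx'.2.le⟩
    simp [g, hx, this]

theorem integral_g (y s : ℝ) : ∫ x, g W y s x = gNorm W y s := by
  rw [gNorm_eq]
  simpa using integral_mul_g (W := W) (fun _ => 1) y s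

theorem continuous_gNorm (hW : Continuous W) : Continuous (fun q : ℝ × ℝ => gNorm W q.1 q.2) := by
  simp only [gNorm_eq]
  refine intervalIntegral.continuous_parametric_intervalIntegral_of_continuous'
    (f := fun (q : ℝ × ℝ) x => max ((W q.1 - W (q.1 + x)) * q.2) 0) ?_ _ _
  simp only [Function.uncurry_def]
  fun_prop

theorem gNorm_nonneg (y s : ℝ) : 0 ≤ gNorm W y s := by
  rw [← integral_g]
  exact integral_nonneg (g_nonneg y s)

/-- The density is at most 2K|s| on an interval of length 2π. Linear growth in |s| is what bounds
the clock speed on strips. -/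
theorem gNorm_le {K : ℝ} (hK : ∀ x, |W x| ≤ K) (y s : ℝ) :
    gNorm W y s ≤ 4 * Real.pi * K * |s| := by
  have h : ∀ x ∈ uIoc (-Real.pi) Real.pi, ‖max ((W y - W (y + x)) * s) 0‖ ≤ 2 * K * |s| := by
    intro x _
    rw [Real.norm_eq_abs, abs_of_nonneg (le_max_right _ _)]
    have h1 : |W y - W (y + x)| ≤ 2 * K := by
      have := abs_sub (W y) (W (y + x))
      linarith [hK y, hK (y + x)]
    refine max_le ((le_abs_self _).trans ?_) (by have := (abs_nonneg (W 0)).trans (hK 0); positivity)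
    rw [abs_mul]
    gcongr
  have := intervalIntegral.norm_integral_le_of_norm_le_const h
  rw [← gNorm_eq, Real.norm_eq_abs, abs_of_nonneg (gNorm_nonneg y s)] at this
  refine this.trans (le_of_eq ?_)
  rw [abs_of_nonneg (by linarith [Real.pi_pos] : 0 ≤ Real.pi - -Real.pi)]
  ring

/-- Uniform control of the jump density under perturbations of `(y, s)`. -/
theorem abs_max_sub_max_le {K m ρ : ℝ} (hK : ∀ x, |W x| ≤ K) {y y' s s' : ℝ}
    (hρ : ∀ x, |W (y' + x) - W (y + x)| ≤ ρ) (hs : |s| ≤ m) (x : ℝ) :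
    |max ((W y' - W (y' + x)) * s') 0 - max ((W y - W (y + x)) * s) 0| ≤
      2 * K * |s' - s| + 2 * ρ * m := by
  refine (abs_max_sub_max_le_abs _ _ _).trans ?_
  have h0 : |W y' - W y| ≤ ρ := by simpa using hρ 0
  have h1 : |W y' - W (y' + x)| ≤ 2 * K := by
    have := abs_sub (W y') (W (y' + x))
    linarith [hK y', hK (y' + x)]
  have h2 : |(W y' - W y) - (W (y' + x) - W (y + x))| ≤ 2 * ρ := by
    have := abs_sub (W y' - W y) (W (y' + x) - W (y + x))
    linarith [hρ x]
  have hm : 0 ≤ m := (abs_nonneg s).trans hs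
  calc |(W y' - W (y' + x)) * s' - (W y - W (y + x)) * s|
      = |(W y' - W (y' + x)) * (s' - s) + ((W y' - W y) - (W (y' + x) - W (y + x))) * s| := by
        ring_nf
    _ ≤ |(W y' - W (y' + x)) * (s' - s)| + |((W y' - W y) - (W (y' + x) - W (y + x))) * s| :=
        abs_add_le _ _
    _ ≤ 2 * K * |s' - s| + 2 * ρ * m := by
        rw [abs_mul, abs_mul]
        gcongr
        exact (abs_nonneg _).trans h2

/-- Stated for the unnormalised density, because the jump law itself need not depend continuously on
(y, s) where `gNorm` vanishes. -/
theorem abs_integral_mul_g_sub_le (hW : Continuous W) {h : ℝ → ℝ} (hh : Continuous h) {H : ℝ}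
    (hH : ∀ x, |h x| ≤ H) {y y' s s' c : ℝ}
    (hc : ∀ x, |max ((W y' - W (y' + x)) * s') 0 - max ((W y - W (y + x)) * s) 0| ≤ c) :
    |(∫ x, h x * g W y' s' x) - ∫ x, h x * g W y s x| ≤ 2 * Real.pi * H * c := by
  rw [integral_mul_g, integral_mul_g, ← intervalIntegral.integral_sub
    (Continuous.intervalIntegrable (by fun_prop) _ _)
    (Continuous.intervalIntegrable (by fun_prop) _ _)]
  have hb : ∀ x ∈ uIoc (-Real.pi) Real.pi, ‖h x * max ((W y' - W (y' + x)) * s') 0 -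
      h x * max ((W y - W (y + x)) * s) 0‖ ≤ H * c := by
    intro x _
    rw [← mul_sub, norm_mul, Real.norm_eq_abs, Real.norm_eq_abs]
    exact mul_le_mul (hH x) (hc x) (abs_nonneg _) ((abs_nonneg _).trans (hH x))
  refine (intervalIntegral.norm_integral_le_of_norm_le_const hb).trans (le_of_eq ?_)
  rw [abs_of_nonneg (by linarith [Real.pi_pos] : 0 ≤ Real.pi - -Real.pi)]
  ring

theorem abs_integral_mul_g_le (hW : Continuous W) {h : ℝ → ℝ} {H : ℝ}
    (hH : ∀ x, |h x| ≤ H) (y s : ℝ) : |∫ x, h x * g W y s x| ≤ H * gNorm W y s := by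
  rw [← integral_g, ← integral_const_mul, ← Real.norm_eq_abs]
  refine norm_integral_le_of_norm_le ((integrable_g hW y s).const_mul H)
    (Eventually.of_forall fun x => ?_)
  rw [norm_mul, Real.norm_eq_abs, Real.norm_eq_abs, abs_of_nonneg (g_nonneg y s x)]
  exact mul_le_mul_of_nonneg_right (hH x) (g_nonneg y s x)

open Classical in
/-- The law of a jump from `(y, s)`. -/
def jumpLaw (W : ℝ → ℝ) (y s : ℝ) : Measure ℝ :=
  if gNorm W y s = 0 then Measure.dirac 0
  else volume.withDensity fun x => ENNReal.ofReal (g W y s x / gNorm W y s)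

theorem measurable_g_section (hW : Continuous W) (y s : ℝ) : Measurable (g W y s) :=
  (measurable_g hW).comp (measurable_const (a := (y, s)) |>.prodMk measurable_id)

theorem isProbabilityMeasure_jumpLaw (hW : Continuous W) (y s : ℝ) :
    IsProbabilityMeasure (jumpLaw W y s) := by
  unfold jumpLaw
  split_ifs with h
  · infer_instance
  · refine ⟨?_⟩
    rw [withDensity_apply _ MeasurableSet.univ, Measure.restrict_univ,
      ← ofReal_integral_eq_lintegral_ofReal ((integrable_g hW y s).div_const _)
        (Eventually.of_forall fun x => div_nonneg (g_nonneg y s x) (gNorm_nonneg y s)),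
      integral_div, integral_g, div_self h, ENNReal.ofReal_one]

theorem jumpCDF_eq_cdf (hW : Continuous W) (y s x : ℝ) :
    jumpCDF W y s x = cdf (jumpLaw W y s) x := by
  have := isProbabilityMeasure_jumpLaw hW y s
  rw [cdf_eq_real]
  unfold jumpCDF jumpLaw
  split_ifs with h h0
  · simp [Measure.real, h0]
  · simp [Measure.real, h0]
  · rw [Measure.real, withDensity_apply _ measurableSet_Iic,
      ← ofReal_integral_eq_lintegral_ofReal ((integrable_g hW y s).div_const _).integrableOn
        (Eventually.of_forall fun x => div_nonneg (g_nonneg y s x) (gNorm_nonneg y s)),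
      ENNReal.toReal_ofReal
        (integral_nonneg fun x => div_nonneg (g_nonneg y s x) (gNorm_nonneg y s))]

theorem jumpQuantile_eq (hW : Continuous W) (y s v : ℝ) :
    jumpQuantile W y s v = sInf {x | v ≤ cdf (jumpLaw W y s) x} := by
  simp only [jumpQuantile, jumpCDF_eq_cdf hW]

theorem jumpQuantile_le_iff (hW : Continuous W) {y s v : ℝ} (hv : v ∈ Ioo (0 : ℝ) 1) (c : ℝ) :
    jumpQuantile W y s v ≤ c ↔ v ≤ jumpCDF W y s c := by
  rw [jumpQuantile_eq hW, jumpCDF_eq_cdf hW, sInf_le_iff_le_cdf _ hv]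

theorem measurable_jumpCDF (hW : Continuous W) (c : ℝ) :
    Measurable (fun q : ℝ × ℝ => jumpCDF W q.1 q.2 c) := by
  unfold jumpCDF
  refine Measurable.ite ((continuous_gNorm hW).measurable (measurableSet_singleton 0))
    measurable_const ?_
  have h : Measurable (fun p : (ℝ × ℝ) × ℝ => g W p.1.1 p.1.2 p.2 / gNorm W p.1.1 p.1.2) :=
    (measurable_g hW).div ((continuous_gNorm hW).measurable.comp measurable_fst)
  exact (h.stronglyMeasurable.integral_prod_right'
    (ν := (volume : Measure ℝ).restrict (Iic c))).measurable

/-- Sublevel sets are read off from `jumpQuantile_le_iff`, which needs `v` in (0,1) at every ω, not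
only almost surely. -/
theorem measurable_jumpQuantile (hW : Continuous W) {Ω : Type*} [MeasurableSpace Ω]
    {a b v : Ω → ℝ} (ha : Measurable a) (hb : Measurable b) (hv : Measurable v)
    (hv01 : ∀ ω, v ω ∈ Ioo (0 : ℝ) 1) :
    Measurable (fun ω => jumpQuantile W (a ω) (b ω) (v ω)) := by
  refine measurable_of_Iic fun c => ?_
  have : (fun ω => jumpQuantile W (a ω) (b ω) (v ω)) ⁻¹' Iic c =
      {ω | v ω ≤ jumpCDF W (a ω) (b ω) c} := by
    ext ω
    exact jumpQuantile_le_iff hW (hv01 ω) c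
  rw [this]
  exact measurableSet_le hv ((measurable_jumpCDF hW c).comp (ha.prodMk hb))

/-- Averaging over the uniform variable turns the jump into an integral against the density. -/
theorem integral_jumpQuantile_mul_gNorm (hW : Continuous W) {h : ℝ → ℝ} (hh : Continuous h)
    (y s : ℝ) :
    (∫ v in Ioo (0 : ℝ) 1, h (jumpQuantile W y s v)) * gNorm W y s = ∫ x, h x * g W y s x := by
  have := isProbabilityMeasure_jumpLaw hW y s
  have hmap : ∫ v in Ioo (0 : ℝ) 1, h (jumpQuantile W y s v) = ∫ x, h x ∂(jumpLaw W y s) := by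
    conv_rhs => rw [← map_sInf_cdf (jumpLaw W y s)]
    rw [integral_map (measurable_sInf_cdf_on _) hh.aestronglyMeasurable]
    simp only [jumpQuantile_eq hW]
  rw [hmap]
  -- If the norm vanishes then `g` is zero almost everywhere, and both sides are 0 whatever the unit
  -- mass at 0 contributes.
  by_cases hG : gNorm W y s = 0
  · have h0 : g W y s =ᵐ[volume] 0 := by
      refine (integral_eq_zero_iff_of_nonneg (g_nonneg y s) (integrable_g hW y s)).1 ?_
      rw [integral_g, hG]
    rw [hG, mul_zero, eq_comm]
    refine integral_eq_zero_of_ae ?_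
    filter_upwards [h0] with x hx
    simp [hx]
  · rw [jumpLaw, if_neg hG, integral_withDensity_eq_integral_toReal_smul
      ((measurable_g_section hW y s).div_const _).ennreal_ofReal
      (Eventually.of_forall fun x => ENNReal.ofReal_lt_top), ← integral_mul_const]
    refine integral_congr_ae (Eventually.of_forall fun x => ?_)
    simp only [smul_eq_mul]
    rw [ENNReal.toReal_ofReal (div_nonneg (g_nonneg y s x) (gNorm_nonneg y s))]
    field_simp

end Density

/-! ### Paths between two jumps -/

section Stage

variable {W : ℝ → ℝ} {K : ℝ} {x : ℝ≥0 → ℝ} {y : ℝ} {p : Stage}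

theorem IsCadlag.stageY (hx : IsCadlag x) (y : ℝ) (p : Stage) : IsCadlag (stageY x y p) := by
  intro t
  obtain ⟨hr, l, hl⟩ := hx t
  exact ⟨(continuousWithinAt_const.add hr).add continuousWithinAt_const, y + l + p.jumps,
    (hl.const_add y).add_const p.jumps⟩

theorem intervalIntegrable_stageY (hW : Continuous W) (hK : ∀ x, |W x| ≤ K) (hx : IsCadlag x)
    (a b : ℝ) : IntervalIntegrable (fun r => W (stageY x y p r.toNNReal)) volume a b := by
  refine (intervalIntegrable_const (c := K)).mono_fun' ?_ (Eventually.of_forall fun r => hK _)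
  exact (hW.measurable.comp ((hx.stageY y p).measurable.comp
    measurable_real_toNNReal)).aestronglyMeasurable

theorem continuous_stageS (hW : Continuous W) (hK : ∀ x, |W x| ≤ K) (hx : IsCadlag x) :
    Continuous (stageS W x y p) :=
  continuous_const.add ((intervalIntegral.continuous_primitive
    (fun a b => intervalIntegrable_stageY hW hK hx a b) _).comp NNReal.continuous_coe)

theorem abs_stageS_sub_memory_le (hK : ∀ x, |W x| ≤ K) (t : ℝ≥0) :
    |stageS W x y p t - p.memory| ≤ K * |(t : ℝ) - p.time.toReal| := by
  rw [stageS, add_sub_cancel_left]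
  exact intervalIntegral.norm_integral_le_of_norm_le_const
    (f := fun r : ℝ => W (stageY x y p r.toNNReal)) fun r _ => hK _

theorem measurable_rate (hW : Continuous W) (hK : ∀ x, |W x| ≤ K) (hx : IsCadlag x) :
    Measurable (fun r : ℝ => gNorm W (stageY x y p r.toNNReal) (stageS W x y p r.toNNReal)) :=
  (continuous_gNorm hW).measurable.comp
    (((hx.stageY y p).measurable.comp measurable_real_toNNReal).prodMk
      ((continuous_stageS hW hK hx).measurable.comp measurable_real_toNNReal))

theorem intervalIntegrable_rate (hW : Continuous W) (hK : ∀ x, |W x| ≤ K) (hx : IsCadlag x)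
    (a b : ℝ) : IntervalIntegrable
      (fun r => gNorm W (stageY x y p r.toNNReal) (stageS W x y p r.toNNReal)) volume a b := by
  have hc : Continuous (fun r : ℝ => 4 * Real.pi * K * |stageS W x y p r.toNNReal|) :=
    continuous_const.mul ((continuous_stageS hW hK hx).comp continuous_real_toNNReal).abs
  refine (hc.intervalIntegrable a b).mono_fun'
    (measurable_rate hW hK hx).aestronglyMeasurable (Eventually.of_forall fun r => ?_)
  beta_reduce
  rw [Real.norm_eq_abs, abs_of_nonneg (gNorm_nonneg _ _)]
  exact gNorm_le hK _ _

theorem continuous_stageClock (hW : Continuous W) (hK : ∀ x, |W x| ≤ K) (hx : IsCadlag x)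
    (a : ℝ≥0) : Continuous (stageClock W x y p a) :=
  continuous_const.add ((intervalIntegral.continuous_primitive
    (fun a b => intervalIntegrable_rate hW hK hx a b) _).comp NNReal.continuous_coe)

theorem monotone_stageClock (hW : Continuous W) (hK : ∀ x, |W x| ≤ K) (hx : IsCadlag x)
    (a : ℝ≥0) : Monotone (stageClock W x y p a) := by
  intro t t' h
  have hadd := intervalIntegral.integral_add_adjacent_intervals
    (intervalIntegrable_rate (y := y) (p := p) hW hK hx p.time.toReal t)
    (intervalIntegrable_rate hW hK hx t t')
  have h0 : 0 ≤ ∫ r in (t : ℝ)..t', gNorm W (stageY x y p r.toNNReal) (stageS W x y p r.toNNReal) :=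
    intervalIntegral.integral_nonneg h fun r _ => gNorm_nonneg _ _
  simp only [stageClock]
  linarith

theorem stageClock_time (a : ℝ≥0) : stageClock W x y p a p.time.toNNReal = a := by
  simp [stageClock, ENNReal.toReal]

/-- The clock has rung by time `c` precisely when it has accumulated the amount `b`. -/
theorem stageEnd_le_iff (hW : Continuous W) (hK : ∀ x, |W x| ≤ K) (hx : IsCadlag x)
    {a b c : ℝ≥0} : stageEnd W x y p a b ≤ c ↔
      a ≤ b ∧ p.time ≤ c ∧ (b : ℝ) ≤ stageClock W x y p a c := by
  have hmono := monotone_stageClock (y := y) (p := p) hW hK hx a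
  have hcont := continuous_stageClock (y := y) (p := p) hW hK hx a
  constructor
  · intro h
    -- The infimum is not yet known to be attained, so a ringing time is taken before each `c' > c`,
    -- and then `c'` decreases to `c` by continuity of the clock. The clock starts at `a` and is
    -- monotone, hence a ringing time forces `a ≤ b`.
    have key : ∀ c' : ℝ≥0, c < c' →
        a ≤ b ∧ p.time ≤ c' ∧ (b : ℝ) ≤ stageClock W x y p a c' := by
      intro c' hc'
      obtain ⟨T, ⟨t, rfl, hpt, htb⟩, hT⟩ :=
        sInf_lt_iff.1 (lt_of_le_of_lt h (ENNReal.coe_lt_coe.2 hc'))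
      have htc : t ≤ c' := (ENNReal.coe_lt_coe.1 hT).le
      refine ⟨?_, hpt.trans hT.le, htb ▸ hmono htc⟩
      have h1 : p.time.toNNReal ≤ t := by
        simpa using ENNReal.toNNReal_mono ENNReal.coe_ne_top hpt
      have h2 := hmono h1
      rw [stageClock_time, htb] at h2
      exact_mod_cast h2
    refine ⟨(key (c + 1) (lt_add_one c)).1, ?_, ?_⟩
    · refine le_of_forall_gt fun d hd => ?_
      obtain ⟨e, he, hed⟩ := ENNReal.lt_iff_exists_nnreal_btwn.1 hd
      exact (key e (ENNReal.coe_lt_coe.1 he)).2.1.trans_lt hed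
    · refine ge_of_tendsto (hcont.continuousWithinAt (s := Ioi c)).tendsto ?_
      filter_upwards [self_mem_nhdsWithin] with c' hc' using (key c' hc').2.2
  · rintro ⟨hab, hpc, hbc⟩
    have hpc' : p.time.toNNReal ≤ c := by
      simpa using ENNReal.toNNReal_mono ENNReal.coe_ne_top hpc
    -- The clock is continuous, equals `a ≤ b` at the start of the stage and is at least `b` at `c`,
    -- so it takes the value `b` in between.
    have hb : (b : ℝ) ∈ Icc (stageClock W x y p a p.time.toNNReal) (stageClock W x y p a c) :=
      ⟨by rw [stageClock_time]; exact_mod_cast hab, hbc⟩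
    obtain ⟨t, ht, htb⟩ := intermediate_value_Icc hpc' hcont.continuousOn hb
    have hpt : p.time ≤ t := by
      rw [← ENNReal.coe_toNNReal (ne_top_of_le_ne_top ENNReal.coe_ne_top hpc)]
      exact ENNReal.coe_le_coe.2 ht.1
    have hmem : stageEnd W x y p a b ≤ t := sInf_le ⟨t, rfl, hpt, htb⟩
    exact hmem.trans (ENNReal.coe_le_coe.2 ht.2)

/-- While |S| ≤ m the clock runs at speed at most 4πKm. This speed governs all later probability
bounds. -/
theorem stageClock_le (hK : ∀ x, |W x| ≤ K) {m : ℝ} {a t : ℝ≥0}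
    (ht : p.time ≤ t) (hm : ∀ r : ℝ≥0, p.time ≤ r → r ≤ t → |stageS W x y p r| ≤ m) :
    stageClock W x y p a t ≤ a + 4 * Real.pi * K * m * (t - p.time.toReal) := by
  have hK0 : 0 ≤ K := (abs_nonneg (W 0)).trans (hK 0)
  have hne : p.time ≠ ∞ := ne_top_of_le_ne_top ENNReal.coe_ne_top ht
  have hle : p.time.toReal ≤ t := by
    simpa using ENNReal.toReal_mono ENNReal.coe_ne_top ht
  have h := intervalIntegral.norm_integral_le_of_norm_le_const (a := p.time.toReal) (b := t)
    (C := 4 * Real.pi * K * m)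
    (f := fun r => gNorm W (stageY x y p r.toNNReal) (stageS W x y p r.toNNReal)) ?_
  · rw [abs_of_nonneg (sub_nonneg.2 hle)] at h
    rw [stageClock]
    linarith [Real.le_norm_self (∫ r in p.time.toReal..(t : ℝ),
      gNorm W (stageY x y p r.toNNReal) (stageS W x y p r.toNNReal))]
  · intro r hr
    rw [uIoc_of_le hle] at hr
    rw [Real.norm_eq_abs, abs_of_nonneg (gNorm_nonneg _ _)]
    refine (gNorm_le hK _ _).trans ?_
    have hr0 : 0 ≤ r := ENNReal.toReal_nonneg.trans hr.1.le
    have := hm r.toNNReal ?_ (Real.toNNReal_le_iff_le_coe.2 hr.2)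
    · gcongr
    · rw [← ENNReal.ofReal_toReal hne]
      exact ENNReal.ofReal_le_ofReal hr.1.le

end Stage

/-! ### The path with jumps -/

section Path

variable {W : ℝ → ℝ} {K : ℝ} {x : ℝ≥0 → ℝ} {σ : ℕ → ℝ≥0} {u : ℕ → ℝ} {y s : ℝ}

theorem stage_succ_le (hW : Continuous W) (hK : ∀ x, |W x| ≤ K) (hx : IsCadlag x) {j : ℕ}
    (h : (stage W x σ u y s (j + 1)).time ≠ ∞) :
    (stage W x σ u y s j).time ≤ (stage W x σ u y s (j + 1)).time := by
  have hle : stageEnd W x y (stage W x σ u y s j) (σ j) (σ (j + 1)) ≤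
      ((stage W x σ u y s (j + 1)).time.toNNReal : ℝ≥0) := by
    rw [ENNReal.coe_toNNReal h]; exact le_rfl
  have := ((stageEnd_le_iff hW hK hx).1 hle).2.1
  rwa [ENNReal.coe_toNNReal h] at this

/-- Jumps move Y but not S, so S has speed at most K regardless of how many jumps have occurred. -/
theorem abs_memory_sub_le (hW : Continuous W) (hK : ∀ x, |W x| ≤ K) (hx : IsCadlag x) (j : ℕ)
    (h : (stage W x σ u y s j).time ≠ ∞) :
    |(stage W x σ u y s j).memory - s| ≤ K * (stage W x σ u y s j).time.toReal := by
  induction j with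
  | zero => simp [stage]
  | succ j ih =>
    have hle := stage_succ_le hW hK hx h
    have hne := ne_top_of_le_ne_top h hle
    -- S is continuous, so its left limit at the jump time is its value there.
    have h1 : (stage W x σ u y s (j + 1)).memory =
        stageS W x y (stage W x σ u y s j) (stage W x σ u y s (j + 1)).time.toNNReal :=
      (continuous_stageS hW hK hx).continuousWithinAt.leftLim_eq
    have h2 := abs_stageS_sub_memory_le (x := x) (y := y) (p := stage W x σ u y s j) hK
      (stage W x σ u y s (j + 1)).time.toNNReal
    have h3 := ENNReal.toReal_mono h hle
    rw [← h1, ENNReal.coe_toNNReal_eq_toReal, abs_of_nonneg (sub_nonneg.2 h3)] at h2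
    have h4 := abs_add_le ((stage W x σ u y s (j + 1)).memory - (stage W x σ u y s j).memory)
      ((stage W x σ u y s j).memory - s)
    rw [sub_add_sub_cancel] at h4
    linarith [ih hne]

theorem abs_stageS_sub_le (hW : Continuous W) (hK : ∀ x, |W x| ≤ K) (hx : IsCadlag x) {j : ℕ}
    {t : ℝ≥0} (h : (stage W x σ u y s j).time ≤ t) :
    |stageS W x y (stage W x σ u y s j) t - s| ≤ K * t := by
  have h1 := abs_memory_sub_le hW hK hx j (ne_top_of_le_ne_top ENNReal.coe_ne_top h)
  have h2 := abs_stageS_sub_memory_le (x := x) (y := y) (p := stage W x σ u y s j) hK t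
  have h3 : (stage W x σ u y s j).time.toReal ≤ t := by
    simpa using ENNReal.toReal_mono ENNReal.coe_ne_top h
  rw [abs_of_nonneg (sub_nonneg.2 h3)] at h2
  have h4 := abs_add_le (stageS W x y (stage W x σ u y s j) t - (stage W x σ u y s j).memory)
    ((stage W x σ u y s j).memory - s)
  rw [sub_add_sub_cancel] at h4
  linarith

theorem abs_pathYS_snd_sub_le (hW : Continuous W) (hK : ∀ x, |W x| ≤ K) (hx : IsCadlag x)
    (q : ℝ × ℝ) (t : ℝ≥0) : |(pathYS W x σ u q t).2 - q.2| ≤ K * t := by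
  refine abs_stageS_sub_le hW hK hx ?_
  rcases Set.eq_empty_or_nonempty {j | (stage W x σ u q.1 q.2 j).time ≤ t ∧
    (t : ℝ≥0∞) < (stage W x σ u q.1 q.2 (j + 1)).time} with h | h
  -- If no index fits `t`, the infimum defaults to 0 and the path is read from stage 0, where the
  -- same bound holds.
  · rw [stageIndex, h, Nat.sInf_empty]
    simp [stage]
  · exact (Nat.sInf_mem h).1

theorem pathHat_eq (q : ℝ × ℝ) (t : ℝ≥0) :
    pathHat W x q t = (stageY x q.1 (stage W x σ u q.1 q.2 0) t,
      stageS W x q.1 (stage W x σ u q.1 q.2 0) t) := by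
  simp [pathHat, stageY, stageS, stage]

theorem abs_pathHat_snd_sub_le (hK : ∀ x, |W x| ≤ K) (q : ℝ × ℝ) (t : ℝ≥0) :
    |(pathHat W x q t).2 - q.2| ≤ K * t := by
  have := abs_stageS_sub_memory_le (x := x) (y := q.1) (p := ⟨0, 0, q.2⟩) hK t
  simpa [pathHat, stageY, stageS] using this

theorem pathYS_eq_pathHat {q : ℝ × ℝ} {t : ℝ≥0}
    (h : (t : ℝ≥0∞) < (stage W x σ u q.1 q.2 1).time) :
    pathYS W x σ u q t = pathHat W x q t := by
  have h0 : stageIndex W x σ u q.1 q.2 t = 0 :=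
    Nat.sInf_eq_zero.2 (Or.inl ⟨by simp [stage], h⟩)
  rw [pathHat_eq (σ := σ) (u := u), pathYS, h0]

theorem pathYS_fst_of_one_jump {q : ℝ × ℝ} {t : ℝ≥0} (h1 : (stage W x σ u q.1 q.2 1).time ≤ t)
    (h2 : (t : ℝ≥0∞) < (stage W x σ u q.1 q.2 2).time) :
    (pathYS W x σ u q t).1 = q.1 + x t + (stage W x σ u q.1 q.2 1).jumps := by
  have hidx : stageIndex W x σ u q.1 q.2 t = 1 := by
    refine le_antisymm (Nat.sInf_le ⟨h1, h2⟩) (Nat.one_le_iff_ne_zero.2 fun h => ?_)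
    have hmem : stageIndex W x σ u q.1 q.2 t ∈ {j | (stage W x σ u q.1 q.2 j).time ≤ t ∧
        (t : ℝ≥0∞) < (stage W x σ u q.1 q.2 (j + 1)).time} := Nat.sInf_mem ⟨1, h1, h2⟩
    rw [h] at hmem
    exact absurd h1 (not_le.2 hmem.2)
  simp only [pathYS, hidx, stageY]

/-- The driving clock has to reach `σ 2` before the second jump. -/
theorem le_of_second_jump (hW : Continuous W) (hK : ∀ x, |W x| ≤ K) (hx : IsCadlag x)
    (hσ : σ 0 = 0) {m : ℝ} {t : ℝ≥0} (hm : |s| + K * t ≤ m)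
    (h : (stage W x σ u y s 2).time ≤ t) : (σ 2 : ℝ) ≤ 4 * Real.pi * K * m * t := by
  have hK0 : 0 ≤ K := (abs_nonneg (W 0)).trans (hK 0)
  have hS : ∀ (j : ℕ) (r : ℝ≥0), (stage W x σ u y s j).time ≤ r → r ≤ t →
      |stageS W x y (stage W x σ u y s j) r| ≤ m := by
    intro j r hr hrt
    have h1 := abs_stageS_sub_le hW hK hx hr
    have h2 := abs_add_le (stageS W x y (stage W x σ u y s j) r - s) s
    rw [sub_add_cancel] at h2
    have h3 : K * (r : ℝ) ≤ K * t := mul_le_mul_of_nonneg_left (NNReal.coe_le_coe.2 hrt) hK0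
    linarith
  obtain ⟨-, h1, hσ2⟩ := (stageEnd_le_iff hW hK hx).1 h
  have hne := ne_top_of_le_ne_top ENNReal.coe_ne_top h1
  have hτ : ((stage W x σ u y s 1).time.toNNReal : ℝ≥0) ≤ t := by
    simpa using ENNReal.toNNReal_mono ENNReal.coe_ne_top h1
  have h1' : stageEnd W x y (stage W x σ u y s 0) (σ 0) (σ 1) ≤
      ((stage W x σ u y s 1).time.toNNReal : ℝ≥0) := by
    rw [ENNReal.coe_toNNReal hne]; exact le_rfl
  obtain ⟨-, h0, hσ1⟩ := (stageEnd_le_iff hW hK hx).1 h1'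
  -- The clock covers σ₁ during [0, τ₁] and σ₂ − σ₁ during [τ₁, t], each at speed at most 4πKm;
  -- adding the two bounds eliminates τ₁.
  have hb1 := stageClock_le (a := σ 0) hK h0 fun r hr hrt => hS 0 r hr (hrt.trans hτ)
  have hb2 := stageClock_le (a := σ 1) hK h1 fun r hr hrt => hS 1 r hr hrt
  rw [hσ] at hb1 hσ1
  have h00 : (stage W x σ u y s 0).time.toReal = 0 := by simp [stage]
  rw [h00, ENNReal.coe_toNNReal_eq_toReal, NNReal.coe_zero] at hb1
  have : (σ 2 : ℝ) ≤ _ := hσ2.trans hb2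
  linarith

theorem le_of_first_jump (hW : Continuous W) (hK : ∀ x, |W x| ≤ K) (hx : IsCadlag x)
    (hσ : σ 0 = 0) {m : ℝ} {t : ℝ≥0} (hm : |s| + K * t ≤ m)
    (h : (stage W x σ u y s 1).time ≤ t) : (σ 1 : ℝ) ≤ 4 * Real.pi * K * m * t := by
  have hK0 : 0 ≤ K := (abs_nonneg (W 0)).trans (hK 0)
  obtain ⟨-, h1, hσ1⟩ := (stageEnd_le_iff hW hK hx).1 h
  have hb := stageClock_le (a := σ 0) (m := m) hK h1 fun r hr hrt => by
    have h1 := abs_stageS_sub_le hW hK hx hr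
    have h2 := abs_add_le (stageS W x y (stage W x σ u y s 0) r - s) s
    rw [sub_add_cancel] at h2
    have h3 : K * (r : ℝ) ≤ K * t := mul_le_mul_of_nonneg_left (NNReal.coe_le_coe.2 hrt) hK0
    linarith
  have h00 : (stage W x σ u y s 0).time.toReal = 0 := by simp [stage]
  rw [h00, hσ, NNReal.coe_zero] at hb
  rw [hσ] at hσ1
  linarith

/-- If the rate stays within `ε` of `G`, then the first jump happens at about the time at which a
clock with the constant rate `G` reaches `σ 1`. -/
theorem first_jump_of_rate_close (hW : Continuous W) (hK : ∀ x, |W x| ≤ K) (hx : IsCadlag x)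
    (hσ : σ 0 = 0) {G ε : ℝ} {t : ℝ≥0}
    (hG : ∀ r ≤ t, |gNorm W (stageY x y (stage W x σ u y s 0) r)
      (stageS W x y (stage W x σ u y s 0) r) - G| ≤ ε) :
    ((stage W x σ u y s 1).time ≤ t → (σ 1 : ℝ) ≤ (G + ε) * t) ∧
    ((σ 1 : ℝ) ≤ (G - ε) * t → (stage W x σ u y s 1).time ≤ t) := by
  have hclock : |stageClock W x y (stage W x σ u y s 0) (σ 0) t - G * t| ≤ ε * t := by
    have h00 : (stage W x σ u y s 0).time.toReal = 0 := by simp [stage]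
    have hGt : G * t = ∫ _r in (0 : ℝ)..(t : ℝ), G := by simp [mul_comm]
    rw [stageClock, h00, hσ, NNReal.coe_zero, zero_add, hGt, ← intervalIntegral.integral_sub
      (intervalIntegrable_rate hW hK hx _ _) intervalIntegrable_const]
    have := intervalIntegral.norm_integral_le_of_norm_le_const (a := 0) (b := t) (C := ε)
      (f := fun r => gNorm W (stageY x y (stage W x σ u y s 0) r.toNNReal)
        (stageS W x y (stage W x σ u y s 0) r.toNNReal) - G) fun r hr => by
          rw [uIoc_of_le t.coe_nonneg] at hr
          exact hG _ (Real.toNNReal_le_iff_le_coe.2 hr.2)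
    rwa [sub_zero, abs_of_nonneg t.coe_nonneg] at this
  obtain ⟨hlo, hhi⟩ := abs_le.1 hclock
  constructor
  · intro h
    have := ((stageEnd_le_iff hW hK hx).1 h).2.2
    linarith
  · intro h
    refine (stageEnd_le_iff hW hK hx).2 ⟨by rw [hσ]; exact zero_le, by simp [stage], ?_⟩
    linarith

end Path

/-! ### Measurability of the construction -/

section Measurability

variable {Ω : Type*} [MeasurableSpace Ω] {W : ℝ → ℝ} {K : ℝ} {X : ℝ≥0 → Ω → ℝ} {y s : ℝ}

/-- A random stage with measurable components. -/
structure MeasurableStage (p : Ω → Stage) : Prop where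
  time : Measurable (fun ω => (p ω).time)
  jumps : Measurable (fun ω => (p ω).jumps)
  memory : Measurable (fun ω => (p ω).memory)

variable {p : Ω → Stage}

theorem measurable_stageY (hX : ∀ t, Measurable (X t)) (hc : ∀ ω, IsCadlag (fun t => X t ω))
    (hp : MeasurableStage p) :
    Measurable (fun z : ℝ≥0 × Ω => stageY (fun t => X t z.2) y (p z.2) z.1) :=
  ((measurable_uncurry_of_cadlag hX hc).const_add y).add (hp.jumps.comp measurable_snd)

theorem measurable_stageS (hW : Continuous W) (hX : ∀ t, Measurable (X t))
    (hc : ∀ ω, IsCadlag (fun t => X t ω)) (hp : MeasurableStage p) :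
    Measurable (fun z : ℝ≥0 × Ω => stageS W (fun t => X t z.2) y (p z.2) z.1) := by
  have h1 : Measurable (fun z : ℝ × Ω => W (stageY (fun t => X t z.2) y (p z.2) z.1.toNNReal)) :=
    hW.measurable.comp ((measurable_stageY hX hc hp).comp
      ((measurable_real_toNNReal.comp measurable_fst).prodMk measurable_snd))
  have h2 : Measurable (fun z : ℝ≥0 × Ω => (((p z.2).time.toReal, (z.1 : ℝ)), z.2)) :=
    (((hp.time.comp measurable_snd).ennreal_toReal).prodMk
      (measurable_coe_nnreal_real.comp measurable_fst)).prodMk measurable_snd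
  have h3 := (measurable_intervalIntegral
    (h := fun r ω => W (stageY (fun t => X t ω) y (p ω) r.toNNReal)) h1).comp h2
  exact (hp.memory.comp measurable_snd).add h3

theorem measurable_stageClock (hW : Continuous W) (hX : ∀ t, Measurable (X t))
    (hc : ∀ ω, IsCadlag (fun t => X t ω)) (hp : MeasurableStage p) {a : Ω → ℝ≥0}
    (ha : Measurable a) :
    Measurable (fun z : ℝ≥0 × Ω => stageClock W (fun t => X t z.2) y (p z.2) (a z.2) z.1) := by
  have h0 : Measurable (fun z : ℝ × Ω => (z.1.toNNReal, z.2)) :=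
    (measurable_real_toNNReal.comp measurable_fst).prodMk measurable_snd
  have h1 : Measurable (fun z : ℝ × Ω => gNorm W (stageY (fun t => X t z.2) y (p z.2) z.1.toNNReal)
      (stageS W (fun t => X t z.2) y (p z.2) z.1.toNNReal)) :=
    (continuous_gNorm hW).measurable.comp (((measurable_stageY hX hc hp).comp h0).prodMk
      ((measurable_stageS hW hX hc hp).comp h0))
  have h2 : Measurable (fun z : ℝ≥0 × Ω => (((p z.2).time.toReal, (z.1 : ℝ)), z.2)) :=
    (((hp.time.comp measurable_snd).ennreal_toReal).prodMk
      (measurable_coe_nnreal_real.comp measurable_fst)).prodMk measurable_snd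
  have h3 := (measurable_intervalIntegral
    (h := fun r ω => gNorm W (stageY (fun t => X t ω) y (p ω) r.toNNReal)
      (stageS W (fun t => X t ω) y (p ω) r.toNNReal)) h1).comp h2
  exact (measurable_coe_nnreal_real.comp (ha.comp measurable_snd)).add h3

/-- `stageEnd_le_iff` replaces the infimum over uncountably many times by a condition on the clock
at the single time `c`. -/
theorem measurable_stageEnd (hW : Continuous W) (hK : ∀ x, |W x| ≤ K) (hX : ∀ t, Measurable (X t))
    (hc : ∀ ω, IsCadlag (fun t => X t ω)) (hp : MeasurableStage p) {a b : Ω → ℝ≥0}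
    (ha : Measurable a) (hb : Measurable b) :
    Measurable (fun ω => stageEnd W (fun t => X t ω) y (p ω) (a ω) (b ω)) := by
  refine measurable_of_Iic fun c => ?_
  induction c using ENNReal.recTopCoe with
  | top => simp
  | coe c =>
    have : (fun ω => stageEnd W (fun t => X t ω) y (p ω) (a ω) (b ω)) ⁻¹' Iic (c : ℝ≥0∞) =
        {ω | a ω ≤ b ω} ∩ ({ω | (p ω).time ≤ c} ∩
          {ω | (b ω : ℝ) ≤ stageClock W (fun t => X t ω) y (p ω) (a ω) c}) := by
      ext ω
      exact stageEnd_le_iff hW hK (hc ω)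
    rw [this]
    refine (measurableSet_le ha hb).inter ((measurableSet_le hp.time measurable_const).inter
      (measurableSet_le (measurable_coe_nnreal_real.comp hb) ?_))
    exact (measurable_stageClock hW hX hc hp ha).comp (measurable_const (a := c) |>.prodMk
      measurable_id)

theorem measurable_leftLim_stageY (hX : ∀ t, Measurable (X t))
    (hc : ∀ ω, IsCadlag (fun t => X t ω)) (hp : MeasurableStage p) {τ : Ω → ℝ≥0}
    (hτ : Measurable τ) :
    Measurable (fun ω => Function.leftLim (stageY (fun t => X t ω) y (p ω)) (τ ω)) :=
  measurable_leftLim (measurable_stageY hX hc hp)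
    (fun ω t => ((hc ω).stageY y (p ω) t).2) hτ

theorem exists_tendsto_stageS (hW : Continuous W) (hK : ∀ x, |W x| ≤ K) {x : ℝ≥0 → ℝ}
    (hx : IsCadlag x) (p : Stage) (t : ℝ≥0) :
    ∃ l, Tendsto (stageS W x y p) (𝓝[<] t) (𝓝 l) :=
  ⟨_, (continuous_stageS hW hK hx).continuousWithinAt.tendsto⟩

theorem measurable_leftLim_stageS (hW : Continuous W) (hK : ∀ x, |W x| ≤ K)
    (hX : ∀ t, Measurable (X t)) (hc : ∀ ω, IsCadlag (fun t => X t ω)) (hp : MeasurableStage p)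
    {τ : Ω → ℝ≥0} (hτ : Measurable τ) :
    Measurable (fun ω => Function.leftLim (stageS W (fun t => X t ω) y (p ω)) (τ ω)) :=
  measurable_leftLim (measurable_stageS hW hX hc hp)
    (fun ω t => exists_tendsto_stageS hW hK (hc ω) (p ω) t) hτ

theorem measurableStage_zero {σ : ℕ → Ω → ℝ≥0} {U : ℕ → Ω → ℝ} : MeasurableStage
    (fun ω => stage W (fun t => X t ω) (fun k => σ k ω) (fun n => U n ω) y s 0) :=
  ⟨measurable_const, measurable_const, measurable_const⟩

theorem measurableStage_stage (hW : Continuous W) (hK : ∀ x, |W x| ≤ K)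
    (hX : ∀ t, Measurable (X t)) (hc : ∀ ω, IsCadlag (fun t => X t ω)) {σ : ℕ → Ω → ℝ≥0}
    (hσ : ∀ k, Measurable (σ k)) {U : ℕ → Ω → ℝ} (hU : ∀ n, Measurable (U n))
    (hU01 : ∀ n ω, U n ω ∈ Ioo (0 : ℝ) 1) (j : ℕ) : MeasurableStage
      (fun ω => stage W (fun t => X t ω) (fun k => σ k ω) (fun n => U n ω) y s j) := by
  induction j with
  | zero => exact measurableStage_zero
  | succ j ih =>
    have hτ := measurable_stageEnd (y := y) hW hK hX hc ih (hσ j) (hσ (j + 1))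
    have hY := measurable_leftLim_stageY (y := y) hX hc ih hτ.ennreal_toNNReal
    have hS := measurable_leftLim_stageS (y := y) hW hK hX hc ih hτ.ennreal_toNNReal
    exact ⟨hτ, ih.jumps.add (measurable_jumpQuantile hW hY hS (hU j) (hU01 j)), hS⟩

theorem measurable_sInf_nat {A : ℕ → Set Ω} (hA : ∀ j, MeasurableSet (A j)) :
    Measurable (fun ω => sInf {j | ω ∈ A j}) := by
  refine measurable_of_Iic fun k => ?_
  -- The second piece is there because the infimum of the empty set is 0.
  have : (fun ω => sInf {j | ω ∈ A j}) ⁻¹' Iic k = (⋃ j ≤ k, A j) ∪ ⋂ j, (A j)ᶜ := by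
    ext ω
    simp only [mem_preimage, mem_Iic, mem_union, mem_iUnion, mem_iInter, mem_compl_iff, exists_prop]
    constructor
    · intro h
      by_cases hne : ∃ j, ω ∈ A j
      · exact Or.inl ⟨_, h, Nat.sInf_mem (s := {j | ω ∈ A j}) hne⟩
      · exact Or.inr (not_exists.1 hne)
    · rintro (⟨j, hj, hω⟩ | h)
      · exact (Nat.sInf_le hω).trans hj
      · have : {j | ω ∈ A j} = ∅ := eq_empty_of_forall_notMem h
        simp [this]
  rw [this]
  exact (MeasurableSet.biUnion (to_countable _) fun j _ => hA j).union
    (MeasurableSet.iInter fun j => (hA j).compl)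

theorem measurable_pathYS (hW : Continuous W) (hK : ∀ x, |W x| ≤ K)
    (hX : ∀ t, Measurable (X t)) (hc : ∀ ω, IsCadlag (fun t => X t ω)) {σ : ℕ → Ω → ℝ≥0}
    (hσ : ∀ k, Measurable (σ k)) {U : ℕ → Ω → ℝ} (hU : ∀ n, Measurable (U n))
    (hU01 : ∀ n ω, U n ω ∈ Ioo (0 : ℝ) 1) (q : ℝ × ℝ) (t : ℝ≥0) :
    Measurable (fun ω => pathYS W (fun t => X t ω) (fun k => σ k ω) (fun n => U n ω) q t) := by
  have hst := fun j => measurableStage_stage (y := q.1) (s := q.2) hW hK hX hc hσ hU hU01 j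
  have hidx : Measurable (fun ω => stageIndex W (fun t => X t ω) (fun k => σ k ω)
      (fun n => U n ω) q.1 q.2 t) :=
    measurable_sInf_nat
      (A := fun j => {ω | (stage W (fun t => X t ω) (fun k => σ k ω) (fun n => U n ω)
          q.1 q.2 j).time ≤ t} ∩ {ω | (t : ℝ≥0∞) < (stage W (fun t => X t ω) (fun k => σ k ω)
          (fun n => U n ω) q.1 q.2 (j + 1)).time})
      fun j => (measurableSet_le (hst j).time measurable_const).inter
        (measurableSet_lt measurable_const (hst (j + 1)).time)
  have hpair : Measurable (fun z : ℕ × Ω =>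
      ((stageY (fun t => X t z.2) q.1 (stage W (fun t => X t z.2) (fun k => σ k z.2)
        (fun n => U n z.2) q.1 q.2 z.1) t,
      stageS W (fun t => X t z.2) q.1 (stage W (fun t => X t z.2) (fun k => σ k z.2)
        (fun n => U n z.2) q.1 q.2 z.1) t) : ℝ × ℝ)) := by
    refine measurable_from_prod_countable_right fun j => ?_
    have ht : Measurable (fun ω : Ω => (t, ω)) := measurable_const.prodMk measurable_id
    exact ((measurable_stageY hX hc (hst j)).comp ht).prodMk
      ((measurable_stageS hW hX hc (hst j)).comp ht)
  exact hpair.comp (hidx.prodMk measurable_id)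

theorem measurable_pathHat (hW : Continuous W) (hX : ∀ t, Measurable (X t))
    (hc : ∀ ω, IsCadlag (fun t => X t ω)) (q : ℝ × ℝ) (t : ℝ≥0) :
    Measurable (fun ω => pathHat W (fun t => X t ω) q t) := by
  have ht : Measurable (fun ω : Ω => (t, ω)) := measurable_const.prodMk measurable_id
  simp only [pathHat_eq (σ := 0) (u := 0)]
  exact ((measurable_stageY hX hc (measurableStage_zero (σ := 0) (U := 0))).comp ht).prodMk
    ((measurable_stageS hW hX hc (measurableStage_zero (σ := 0) (U := 0))).comp ht)

end Measurability

/-! ### Regular versions of the driving processes -/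

/-- Driving processes all of whose paths are regular: `X` is càdlàg from `0`, `σ` are the jump
times of a Poisson process, of which only small-time estimates are recorded, `U 0` is uniform. -/
structure RegularDrivers {Ω : Type*} [MeasurableSpace Ω] (P : Measure Ω) (X : ℝ≥0 → Ω → ℝ)
    (σ : ℕ → Ω → ℝ≥0) (U : ℕ → Ω → ℝ) : Prop where
  measurable_X : ∀ t, Measurable (X t)
  cadlag : ∀ ω, IsCadlag (fun t => X t ω)
  start : ∀ ω, X 0 ω = 0
  measurable_σ : ∀ k, Measurable (σ k)
  σ_zero : ∀ ω, σ 0 ω = 0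
  measurable_U : ∀ n, Measurable (U n)
  U_mem : ∀ n ω, U n ω ∈ Ioo (0 : ℝ) 1
  law_U : P.map (U 0) = (volume : Measure ℝ).restrict (Ioo 0 1)
  indep_σ : IndepFun (fun ω t => X t ω) (fun ω k => σ k ω) P
  indep_U : IndepFun (fun ω => ((fun t => X t ω), (fun k => σ k ω))) (U 0) P
  first_le : ∀ a : ℝ, 0 ≤ a → P.real {ω | (σ 1 ω : ℝ) ≤ a} ≤ a
  le_first : ∀ a : ℝ, 0 ≤ a → a - a ^ 2 ≤ P.real {ω | (σ 1 ω : ℝ) ≤ a}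
  second_le : ∀ a : ℝ, 0 ≤ a → P.real {ω | (σ 2 ω : ℝ) ≤ a} ≤ a ^ 2

/-- The time of the first jump. -/
def firstTime (W : ℝ → ℝ) (x : ℝ≥0 → ℝ) (σ : ℕ → ℝ≥0) (q : ℝ × ℝ) : ℝ≥0∞ :=
  stageEnd W x q.1 ⟨0, 0, q.2⟩ (σ 0) (σ 1)

/-- The position just before the first jump. -/
def firstLeft (W : ℝ → ℝ) (x : ℝ≥0 → ℝ) (σ : ℕ → ℝ≥0) (q : ℝ × ℝ) : ℝ × ℝ :=
  (Function.leftLim (stageY x q.1 ⟨0, 0, q.2⟩) (firstTime W x σ q).toNNReal,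
    Function.leftLim (stageS W x q.1 ⟨0, 0, q.2⟩) (firstTime W x σ q).toNNReal)

/-! ### The first jump: state before it, average over the uniform variable, small-time paths -/

section Core

variable {Ω : Type*} {mΩ : MeasurableSpace Ω} {P : Measure Ω} {W : ℝ → ℝ} {K : ℝ}
  {X : ℝ≥0 → Ω → ℝ} {σ : ℕ → Ω → ℝ≥0} {U : ℕ → Ω → ℝ}

theorem stage_one_jumps (x : ℝ≥0 → ℝ) (σ : ℕ → ℝ≥0) (u : ℕ → ℝ) (q : ℝ × ℝ) :
    (stage W x σ u q.1 q.2 1).jumps =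
      jumpQuantile W (firstLeft W x σ q).1 (firstLeft W x σ q).2 (u 0) :=
  zero_add _

theorem measurable_firstTime (hW : Continuous W) (hK : ∀ x, |W x| ≤ K)
    (hX : ∀ t, Measurable (X t)) (hc : ∀ ω, IsCadlag (fun t => X t ω))
    (hσ : ∀ k, Measurable (σ k)) (q : ℝ × ℝ) :
    Measurable (fun ω => firstTime W (fun t => X t ω) (fun k => σ k ω) q) :=
  measurable_stageEnd (p := fun _ => ⟨0, 0, q.2⟩) hW hK hX hc
    ⟨measurable_const, measurable_const, measurable_const⟩ (hσ 0) (hσ 1)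

theorem measurable_firstLeft (hW : Continuous W) (hK : ∀ x, |W x| ≤ K)
    (hX : ∀ t, Measurable (X t)) (hc : ∀ ω, IsCadlag (fun t => X t ω))
    (hσ : ∀ k, Measurable (σ k)) (q : ℝ × ℝ) :
    Measurable (fun ω => firstLeft W (fun t => X t ω) (fun k => σ k ω) q) := by
  have hp : MeasurableStage (fun _ : Ω => (⟨0, 0, q.2⟩ : Stage)) :=
    ⟨measurable_const, measurable_const, measurable_const⟩
  have hτ := (measurable_firstTime hW hK hX hc hσ q).ennreal_toNNReal
  exact (measurable_leftLim_stageY hX hc hp hτ).prodMk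
    (measurable_leftLim_stageS hW hK hX hc hp hτ)

theorem abs_firstLeft_sub_le (hW : Continuous W) (hK : ∀ x, |W x| ≤ K) {x : ℝ≥0 → ℝ}
    (hx : IsCadlag x) {σ : ℕ → ℝ≥0} {q : ℝ × ℝ} {t : ℝ≥0} {δ : ℝ}
    (hδ : ∀ r ≤ t, |x r| ≤ δ) (h : firstTime W x σ q ≤ t) :
    |(firstLeft W x σ q).1 - q.1| ≤ δ ∧ |(firstLeft W x σ q).2 - q.2| ≤ K * t := by
  have hK0 : 0 ≤ K := (abs_nonneg (W 0)).trans (hK 0)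
  have hτ : (firstTime W x σ q).toNNReal ≤ t := by
    simpa using ENNReal.toNNReal_mono ENNReal.coe_ne_top h
  refine ⟨abs_leftLim_sub_le ((hx.stageY q.1 _ _).2) fun r hr => ?_,
    abs_leftLim_sub_le (exists_tendsto_stageS hW hK hx _ _) fun r hr => ?_⟩
  · simpa [stageY] using hδ r (hr.trans hτ)
  · refine (abs_stageS_sub_memory_le (p := ⟨0, 0, q.2⟩) hK r).trans ?_
    simp only [ENNReal.toReal_zero, sub_zero, NNReal.abs_eq]
    exact mul_le_mul_of_nonneg_left (NNReal.coe_le_coe.2 (hr.trans hτ)) hK0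

/-- Replacing values outside (0,1) by 1/2 gives a variable to which `measurable_jumpQuantile`
applies everywhere and leaves values in (0,1) unchanged. -/
theorem measurable_clip : Measurable (fun v : ℝ => if v ∈ Ioo (0 : ℝ) 1 then v else 1 / 2) :=
  Measurable.ite measurableSet_Ioo measurable_id measurable_const

theorem clip_mem (v : ℝ) : (if v ∈ Ioo (0 : ℝ) 1 then v else 1 / 2) ∈ Ioo (0 : ℝ) 1 := by
  split_ifs with h
  · exact h
  · norm_num

theorem measurable_average (hW : Continuous W) {h : ℝ → ℝ} (hh : Continuous h) :
    Measurable (fun q : ℝ × ℝ => ∫ v in Ioo (0 : ℝ) 1, h (jumpQuantile W q.1 q.2 v)) := by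
  have hm : Measurable (fun z : (ℝ × ℝ) × ℝ =>
      h (jumpQuantile W z.1.1 z.1.2 (if z.2 ∈ Ioo (0 : ℝ) 1 then z.2 else 1 / 2))) :=
    hh.measurable.comp (measurable_jumpQuantile hW (measurable_fst.comp measurable_fst)
      (measurable_snd.comp measurable_fst) (measurable_clip.comp measurable_snd)
      fun z => clip_mem z.2)
  have := (hm.stronglyMeasurable.integral_prod_right'
    (ν := (volume : Measure ℝ).restrict (Ioo 0 1))).measurable
  convert! this using 2 with q
  refine setIntegral_congr_fun measurableSet_Ioo fun v hv => ?_
  simp only [if_pos hv]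

theorem abs_average_le {h : ℝ → ℝ} {H : ℝ} (hH : ∀ x, |h x| ≤ H) (y s : ℝ) :
    |∫ v in Ioo (0 : ℝ) 1, h (jumpQuantile W y s v)| ≤ H := by
  have := norm_setIntegral_le_of_norm_le_const (μ := (volume : Measure ℝ)) (s := Ioo (0 : ℝ) 1)
    (f := fun v => h (jumpQuantile W y s v)) (C := H) (by simp) fun v _ => hH _
  simpa using this

/-- Averaging the first jump over the uniform variable, which is independent of the position just
before the jump. -/
theorem RegularDrivers.integral_firstJump [IsProbabilityMeasure P] (D : RegularDrivers P X σ U)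
    (hW : Continuous W) (hK : ∀ x, |W x| ≤ K) {h : ℝ → ℝ} (hh : Continuous h) {H : ℝ}
    (hH : ∀ x, |h x| ≤ H) (q : ℝ × ℝ) (t : ℝ≥0) :
    ∫ ω, {ω | firstTime W (fun t => X t ω) (fun k => σ k ω) q ≤ t}.indicator (fun ω =>
      h (jumpQuantile W (firstLeft W (fun t => X t ω) (fun k => σ k ω) q).1
        (firstLeft W (fun t => X t ω) (fun k => σ k ω) q).2 (U 0 ω))) ω ∂P =
    ∫ ω, {ω | firstTime W (fun t => X t ω) (fun k => σ k ω) q ≤ t}.indicator (fun ω =>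
      ∫ v in Ioo (0 : ℝ) 1, h (jumpQuantile W (firstLeft W (fun t => X t ω) (fun k => σ k ω) q).1
        (firstLeft W (fun t => X t ω) (fun k => σ k ω) q).2 v)) ω ∂P := by
  set path : Ω → (ℝ≥0 → ℝ) × (ℕ → ℝ≥0) := fun ω => ((fun t => X t ω), (fun k => σ k ω)) with hpath
  set A : Ω → (ℝ × ℝ) × ℝ≥0∞ := fun ω => (firstLeft W (fun t => X t ω) (fun k => σ k ω) q,
    firstTime W (fun t => X t ω) (fun k => σ k ω) q) with hA
  -- The measurability lemmas are rerun with the σ-algebra generated by the driving paths in place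
  -- of the one on Ω. The state before the jump is thus a function of (X, σ), hence independent of
  -- `U 0`.
  have hXm : ∀ t, Measurable[MeasurableSpace.comap path inferInstance] (X t) := fun t =>
    ((measurable_pi_apply t).comp measurable_fst).comp (comap_measurable path)
  have hσm : ∀ k, Measurable[MeasurableSpace.comap path inferInstance] (σ k) := fun k =>
    ((measurable_pi_apply k).comp measurable_snd).comp (comap_measurable path)
  have hAm : Measurable[MeasurableSpace.comap path inferInstance] A :=
    Measurable.prodMk (m := MeasurableSpace.comap path inferInstance)
      (measurable_firstLeft (mΩ := MeasurableSpace.comap path inferInstance)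
        hW hK hXm D.cadlag hσm q)
      (measurable_firstTime (mΩ := MeasurableSpace.comap path inferInstance)
        hW hK hXm D.cadlag hσm q)
  have hAm' : Measurable A :=
    (measurable_firstLeft hW hK D.measurable_X D.cadlag D.measurable_σ q).prodMk
      (measurable_firstTime hW hK D.measurable_X D.cadlag D.measurable_σ q)
  have hind : IndepFun A (U 0) P := by
    rw [IndepFun_iff_Indep]
    refine indep_of_indep_of_le_left ((IndepFun_iff_Indep _ _ _).1 D.indep_U) ?_
    exact hAm.comap_le
  have hprod := (indepFun_iff_map_prod_eq_prod_map_map hAm'.aemeasurable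
    (D.measurable_U 0).aemeasurable).1 hind
  rw [D.law_U] at hprod
  set Φ : ((ℝ × ℝ) × ℝ≥0∞) × ℝ → ℝ := fun z => {z : ((ℝ × ℝ) × ℝ≥0∞) × ℝ | z.1.2 ≤ t}.indicator
    (fun z => h (jumpQuantile W z.1.1.1 z.1.1.2 (if z.2 ∈ Ioo (0 : ℝ) 1 then z.2 else 1 / 2))) z
    with hΦ
  have hΦm : Measurable Φ := by
    refine Measurable.indicator ?_ (measurableSet_le (by fun_prop) measurable_const)
    exact hh.measurable.comp (measurable_jumpQuantile hW (by fun_prop) (by fun_prop)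
      (measurable_clip.comp measurable_snd) fun z => clip_mem z.2)
  have hprob : IsProbabilityMeasure (P.map A) := Measure.isProbabilityMeasure_map hAm'.aemeasurable
  have hfin : IsFiniteMeasure ((volume : Measure ℝ).restrict (Ioo (0 : ℝ) 1)) := ⟨by simp⟩
  have hH0 : 0 ≤ H := (abs_nonneg _).trans (hH 0)
  have hΦi : Integrable Φ ((P.map A).prod ((volume : Measure ℝ).restrict (Ioo 0 1))) := by
    refine Integrable.of_bound hΦm.aestronglyMeasurable H (Eventually.of_forall fun z => ?_)
    by_cases hz : z.1.2 ≤ t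
    · simp only [hΦ]
      rw [indicator_of_mem (by exact hz)]
      exact hH _
    · simp only [hΦ]
      rw [indicator_of_notMem (by exact hz), norm_zero]
      exact hH0
  have hinner : ∀ ω, ∫ v in Ioo (0 : ℝ) 1, Φ (A ω, v) =
      {ω | firstTime W (fun t => X t ω) (fun k => σ k ω) q ≤ t}.indicator (fun ω =>
      ∫ v in Ioo (0 : ℝ) 1, h (jumpQuantile W (firstLeft W (fun t => X t ω) (fun k => σ k ω) q).1
        (firstLeft W (fun t => X t ω) (fun k => σ k ω) q).2 v)) ω := by
    intro ω
    by_cases hω : firstTime W (fun t => X t ω) (fun k => σ k ω) q ≤ t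
    · rw [indicator_of_mem (by exact hω)]
      refine setIntegral_congr_fun measurableSet_Ioo fun v hv => ?_
      simp only [hΦ, hA]
      rw [indicator_of_mem (by exact hω)]
      simp only [if_pos hv]
    · rw [indicator_of_notMem (by exact hω)]
      refine setIntegral_eq_zero_of_forall_eq_zero fun v _ => ?_
      exact indicator_of_notMem (by exact hω) _
  calc _ = ∫ ω, Φ (A ω, U 0 ω) ∂P := by
        refine integral_congr_ae (Eventually.of_forall fun ω => ?_)
        simp only [hΦ, hA, indicator_apply, if_pos (D.U_mem 0 ω), mem_ofPred_eq]
    _ = ∫ z, Φ z ∂(P.map fun ω => (A ω, U 0 ω)) := by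
        rw [integral_map (hAm'.prodMk (D.measurable_U 0)).aemeasurable hΦm.aestronglyMeasurable]
    _ = ∫ a, (∫ v in Ioo (0 : ℝ) 1, Φ (a, v)) ∂(P.map A) := by
        rw [hprod, integral_prod _ hΦi]
    _ = ∫ ω, (∫ v in Ioo (0 : ℝ) 1, Φ (A ω, v)) ∂P := by
        rw [integral_map hAm'.aemeasurable
          (hΦm.stronglyMeasurable.integral_prod_right').aestronglyMeasurable]
    _ = _ := by simp only [hinner]

/-- Right-continuity at time `0`, uniformly outside of an event of small probability. -/
theorem RegularDrivers.exists_small_path [IsProbabilityMeasure P] (D : RegularDrivers P X σ U)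
    {δ η : ℝ} (hδ : 0 < δ) (hη : 0 < η) :
    ∃ (t₀ : ℝ≥0) (S : Set (ℝ≥0 → ℝ)), 0 < t₀ ∧ MeasurableSet S ∧
      P.real {ω | (fun t => X t ω) ∉ S} ≤ η ∧
      ∀ ω, (fun t => X t ω) ∈ S → ∀ r < t₀, |X r ω| ≤ δ := by
  obtain ⟨Q, hQc, hQd⟩ := TopologicalSpace.exists_countable_dense ℝ≥0
  -- Only a countable dense set of times is tested, so `S n` is measurable in path space and
  -- independence from the clock can be applied to it; right-continuity extends the bound to all
  -- times.
  set S : ℕ → Set (ℝ≥0 → ℝ) := fun n =>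
    ⋂ r ∈ Q ∩ Iio (1 / ((n : ℝ≥0) + 1)), {x | |x r| ≤ δ} with hS
  have hSm : ∀ n, MeasurableSet (S n) := fun n =>
    MeasurableSet.biInter (hQc.mono inter_subset_left) fun r _ =>
      measurableSet_le (measurable_pi_apply r).abs measurable_const
  have hXp : Measurable (fun ω t => X t ω) := measurable_pi_iff.2 D.measurable_X
  have hSmono : Monotone S := by
    intro n m hnm x hx
    simp only [hS, mem_iInter] at hx ⊢
    intro r hr
    have hnm' : (n : ℝ≥0) ≤ m := by exact_mod_cast hnm
    have hle : 1 / ((m : ℝ≥0) + 1) ≤ 1 / ((n : ℝ≥0) + 1) := by gcongr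
    exact hx r ⟨hr.1, Iio_subset_Iio hle hr.2⟩
  have hgood : ∀ n ω, (fun t => X t ω) ∈ S n → ∀ r < 1 / ((n : ℝ≥0) + 1), |X r ω| ≤ δ := by
    intro n ω hω r hr
    by_contra! hlt
    have hev : ∀ᶠ r' in 𝓝[>] r, δ < |X r' ω| :=
      ((D.cadlag ω r).1.abs.mono Ioi_subset_Ici_self).eventually_const_lt hlt
    obtain ⟨c, hc, hsub⟩ := (mem_nhdsGT_iff_exists_Ioo_subset).1 hev
    have hne : (Ioo r (min c (1 / ((n : ℝ≥0) + 1)))).Nonempty := nonempty_Ioo.2 (lt_min hc hr)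
    obtain ⟨r', hr', hr'Q⟩ := hQd.inter_open_nonempty _ isOpen_Ioo hne
    simp only [hS, mem_iInter] at hω
    have h1 : |X r' ω| ≤ δ := hω r' ⟨hr'Q, hr'.2.trans_le (min_le_right _ _)⟩
    have h2 : δ < |X r' ω| := hsub ⟨hr'.1, hr'.2.trans_le (min_le_left _ _)⟩
    exact absurd h1 (not_le.2 h2)
  -- Right-continuity at 0, where X vanishes, puts every path into some `S n`, so the complements
  -- decrease to the empty set.
  have hlim : Tendsto (fun n => P {ω | (fun t => X t ω) ∉ S n}) atTop (𝓝 0) := by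
    have hempty : ⋂ n, {ω | (fun t => X t ω) ∉ S n} = ∅ := by
      refine eq_empty_of_forall_notMem fun ω hω => ?_
      have hev : ∀ᶠ r' in 𝓝[≥] (0 : ℝ≥0), |X r' ω| < δ := by
        refine (D.cadlag ω 0).1.abs.tendsto.eventually_lt_const ?_
        simpa [D.start ω] using hδ
      obtain ⟨c, hc, hsub⟩ := (mem_nhdsGE_iff_exists_Ico_subset).1 hev
      obtain ⟨n, hn⟩ := exists_nat_one_div_lt (K := ℝ≥0) hc
      refine mem_iInter.1 hω n ?_
      simp only [hS, mem_iInter]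
      intro r hr
      have hlt : |X r ω| < δ := hsub ⟨zero_le, hr.2.trans hn⟩
      exact hlt.le
    rw [← measure_empty (μ := P), ← hempty]
    refine tendsto_measure_iInter_atTop (fun n => (hXp (hSm n).compl).nullMeasurableSet)
      (fun n m hnm ω hω h => hω (hSmono hnm h)) ⟨0, measure_ne_top _ _⟩
  obtain ⟨n, hn⟩ := (hlim.eventually_lt_const (ENNReal.ofReal_pos.2 hη)).exists
  refine ⟨1 / ((n : ℝ≥0) + 1), S n, by positivity, hSm n, ?_, hgood n⟩
  exact ENNReal.toReal_le_of_le_ofReal hη.le hn.le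

end Core

/-! ### The small-time estimate -/

section Estimate

variable {Ω : Type*} {mΩ : MeasurableSpace Ω} {P : Measure Ω} {W : ℝ → ℝ} {K : ℝ}
  {X : ℝ≥0 → Ω → ℝ} {σ : ℕ → Ω → ℝ≥0} {U : ℕ → Ω → ℝ}

/-- The event that the first jump happens by time `t`. -/
def jumpEvent (W : ℝ → ℝ) (X : ℝ≥0 → Ω → ℝ) (σ : ℕ → Ω → ℝ≥0) (q : ℝ × ℝ) (t : ℝ≥0) : Set Ω :=
  {ω | firstTime W (fun t => X t ω) (fun k => σ k ω) q ≤ t}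

/-- The event that the path of `X` is not in `S` although the clock `σ 1` rings before `a`. -/
def badEvent (X : ℝ≥0 → Ω → ℝ) (σ : ℕ → Ω → ℝ≥0) (S : Set (ℝ≥0 → ℝ)) (a : ℝ) : Set Ω :=
  {ω | (fun t => X t ω) ∉ S} ∩ {ω | (σ 1 ω : ℝ) ≤ a}

theorem RegularDrivers.measurableSet_jumpEvent (D : RegularDrivers P X σ U) (hW : Continuous W)
    (hK : ∀ x, |W x| ≤ K) (q : ℝ × ℝ) (t : ℝ≥0) : MeasurableSet (jumpEvent W X σ q t) :=
  measurableSet_le (measurable_firstTime hW hK D.measurable_X D.cadlag D.measurable_σ q)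
    measurable_const

theorem RegularDrivers.measurableSet_le_σ (D : RegularDrivers P X σ U) (k : ℕ) (a : ℝ) :
    MeasurableSet {ω | (σ k ω : ℝ) ≤ a} :=
  measurableSet_le (measurable_coe_nnreal_real.comp (D.measurable_σ k)) measurable_const

theorem RegularDrivers.measurableSet_badEvent (D : RegularDrivers P X σ U)
    {S : Set (ℝ≥0 → ℝ)} (hS : MeasurableSet S) (a : ℝ) : MeasurableSet (badEvent X σ S a) :=
  ((measurable_pi_iff.2 D.measurable_X) hS.compl).inter (D.measurableSet_le_σ 1 a)

/-- Independence yields a product: the small probability of leaving `S` gains the factor `a`, of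
order t in the application. Without it the term would not survive division by t. -/
theorem RegularDrivers.badEvent_le (D : RegularDrivers P X σ U)
    {S : Set (ℝ≥0 → ℝ)} (hS : MeasurableSet S) {a : ℝ} (ha : 0 ≤ a) :
    P.real (badEvent X σ S a) ≤ P.real {ω | (fun t => X t ω) ∉ S} * a := by
  have hm : MeasurableSet {z : ℕ → ℝ≥0 | (z 1 : ℝ) ≤ a} :=
    measurableSet_le (measurable_coe_nnreal_real.comp (measurable_pi_apply 1)) measurable_const
  have h := D.indep_σ.measure_inter_preimage_eq_mul Sᶜ {z | (z 1 : ℝ) ≤ a} hS.compl hm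
  have h' : P.real (badEvent X σ S a) =
      P.real {ω | (fun t => X t ω) ∉ S} * P.real {ω | (σ 1 ω : ℝ) ≤ a} := by
    simp only [Measure.real, ← ENNReal.toReal_mul]
    exact congrArg ENNReal.toReal h
  rw [h']
  exact mul_le_mul_of_nonneg_left (D.first_le a ha) measureReal_nonneg

/-- The path stays within `δ` of its start on `S`, and within this distance the jump density
varies by at most `ρ`. -/
structure LocalControl (W : ℝ → ℝ) (K : ℝ) (X : ℝ≥0 → Ω → ℝ) (q : ℝ × ℝ) (t : ℝ≥0)
    (S : Set (ℝ≥0 → ℝ)) (δ ρ m : ℝ) : Prop where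
  measurableSet : MeasurableSet S
  path : ∀ ω, (fun t => X t ω) ∈ S → ∀ r ≤ t, |X r ω| ≤ δ
  density : ∀ y' s', |y' - q.1| ≤ δ → |s' - q.2| ≤ K * t → ∀ x,
    |max ((W y' - W (y' + x)) * s') 0 - max ((W q.1 - W (q.1 + x)) * q.2) 0| ≤ ρ
  memory : |q.2| + K * t ≤ m

variable {q : ℝ × ℝ} {t : ℝ≥0} {S : Set (ℝ≥0 → ℝ)} {δ ρ m : ℝ}

theorem LocalControl.abs_gNorm_sub_le (L : LocalControl W K X q t S δ ρ m) (hW : Continuous W)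
    {y' s' : ℝ} (hy : |y' - q.1| ≤ δ) (hs : |s' - q.2| ≤ K * t) :
    |gNorm W y' s' - gNorm W q.1 q.2| ≤ 2 * Real.pi * ρ := by
  have := abs_integral_mul_g_sub_le hW (h := fun _ => 1) continuous_const (H := 1) (by simp)
    (L.density y' s' hy hs)
  simpa [integral_g] using this

theorem RegularDrivers.jumpEvent_subset (D : RegularDrivers P X σ U) (hW : Continuous W)
    (hK : ∀ x, |W x| ≤ K) (L : LocalControl W K X q t S δ ρ m) {ω : Ω}
    (hω : ω ∈ jumpEvent W X σ q t) : (σ 1 ω : ℝ) ≤ 4 * Real.pi * K * m * t :=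
  le_of_first_jump (σ := fun k => σ k ω) (u := fun n => U n ω) (y := q.1)
    hW hK (D.cadlag ω) (D.σ_zero ω) L.memory hω

theorem RegularDrivers.jump_iff_of_mem (D : RegularDrivers P X σ U) (hW : Continuous W)
    (hK : ∀ x, |W x| ≤ K) (L : LocalControl W K X q t S δ ρ m) {ω : Ω}
    (hω : (fun t => X t ω) ∈ S) :
    (ω ∈ jumpEvent W X σ q t → (σ 1 ω : ℝ) ≤ (gNorm W q.1 q.2 + 2 * Real.pi * ρ) * t) ∧
    ((σ 1 ω : ℝ) ≤ (gNorm W q.1 q.2 - 2 * Real.pi * ρ) * t → ω ∈ jumpEvent W X σ q t) := by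
  have hK0 : 0 ≤ K := (abs_nonneg (W 0)).trans (hK 0)
  refine first_jump_of_rate_close (σ := fun k => σ k ω) (u := fun n => U n ω) (y := q.1)
    (s := q.2) hW hK (D.cadlag ω) (D.σ_zero ω) fun r hr => L.abs_gNorm_sub_le hW ?_ ?_
  · simpa [stageY, stage] using L.path ω hω r hr
  · refine (abs_stageS_sub_le hW hK (D.cadlag ω) (by simp [stage])).trans ?_
    exact mul_le_mul_of_nonneg_left (NNReal.coe_le_coe.2 hr) hK0

/-- Off the bad event the rate stays within ε = 2πρ of G = `gNorm W q.1 q.2`, so the jump event is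
squeezed between {σ₁ ≤ (G − ε)t} and {σ₁ ≤ (G + ε)t}. -/
theorem RegularDrivers.jumpEvent_prob [IsProbabilityMeasure P] (D : RegularDrivers P X σ U)
    (hW : Continuous W) (hK : ∀ x, |W x| ≤ K) (L : LocalControl W K X q t S δ ρ m) (hρ : 0 ≤ ρ) :
    P.real (jumpEvent W X σ q t) ≤ (gNorm W q.1 q.2 + 2 * Real.pi * ρ) * t +
        P.real (badEvent X σ S (4 * Real.pi * K * m * t)) ∧
    gNorm W q.1 q.2 * t - 2 * Real.pi * ρ * t - (4 * Real.pi * K * m * t) ^ 2 -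
        P.real (badEvent X σ S (4 * Real.pi * K * m * t)) ≤ P.real (jumpEvent W X σ q t) := by
  have hK0 : 0 ≤ K := (abs_nonneg (W 0)).trans (hK 0)
  have ht : (0 : ℝ) ≤ t := t.coe_nonneg
  have hpi := Real.pi_pos
  have hG := gNorm_nonneg (W := W) q.1 q.2
  have hGm : gNorm W q.1 q.2 ≤ 4 * Real.pi * K * m := by
    refine (gNorm_le hK _ _).trans ?_
    have hKt : 0 ≤ K * t := by positivity
    have hqm : |q.2| ≤ m := by linarith [L.memory]
    gcongr
  constructor
  · have hsub : jumpEvent W X σ q t ⊆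
        {ω | (σ 1 ω : ℝ) ≤ (gNorm W q.1 q.2 + 2 * Real.pi * ρ) * t} ∪
          badEvent X σ S (4 * Real.pi * K * m * t) := by
      intro ω hω
      by_cases hS : (fun t => X t ω) ∈ S
      · exact Or.inl ((D.jump_iff_of_mem hW hK L hS).1 hω)
      · exact Or.inr ⟨hS, D.jumpEvent_subset hW hK L hω⟩
    refine (measureReal_mono hsub).trans ((measureReal_union_le _ _).trans ?_)
    gcongr
    exact D.first_le _ (by positivity)
  -- If G ≤ ε the claimed lower bound is nonpositive.
  · rcases le_or_gt (gNorm W q.1 q.2) (2 * Real.pi * ρ) with h | h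
    · have h1 : gNorm W q.1 q.2 * t ≤ 2 * Real.pi * ρ * t := by gcongr
      have h2 : 0 ≤ P.real (jumpEvent W X σ q t) := measureReal_nonneg
      have h3 : 0 ≤ P.real (badEvent X σ S (4 * Real.pi * K * m * t)) := measureReal_nonneg
      nlinarith [sq_nonneg (4 * Real.pi * K * m * t)]
    · set a := (gNorm W q.1 q.2 - 2 * Real.pi * ρ) * t with ha
      have ha0 : 0 ≤ a := mul_nonneg (sub_nonneg.2 h.le) ht
      have haΛ : a ≤ 4 * Real.pi * K * m * t := by
        have : 0 ≤ 2 * Real.pi * ρ := by positivity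
        exact mul_le_mul_of_nonneg_right (by linarith) ht
      have hsub : {ω | (σ 1 ω : ℝ) ≤ a} ⊆
          jumpEvent W X σ q t ∪ badEvent X σ S (4 * Real.pi * K * m * t) := by
        intro ω hω
        by_cases hS : (fun t => X t ω) ∈ S
        · exact Or.inl ((D.jump_iff_of_mem hW hK L hS).2 hω)
        · exact Or.inr ⟨hS, le_trans hω haΛ⟩
      have h1 := (D.le_first a ha0).trans ((measureReal_mono hsub).trans (measureReal_union_le _ _))
      have h2 : a ^ 2 ≤ (4 * Real.pi * K * m * t) ^ 2 := pow_le_pow_left₀ ha0 haΛ 2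
      have h3 : a = gNorm W q.1 q.2 * t - 2 * Real.pi * ρ * t := by rw [ha]; ring
      linarith

theorem RegularDrivers.abs_firstLeft_sub_le (D : RegularDrivers P X σ U) (hW : Continuous W)
    (hK : ∀ x, |W x| ≤ K) (L : LocalControl W K X q t S δ ρ m) {ω : Ω}
    (hω : (fun t => X t ω) ∈ S) (hj : ω ∈ jumpEvent W X σ q t) :
    |(firstLeft W (fun t => X t ω) (fun k => σ k ω) q).1 - q.1| ≤ δ ∧
      |(firstLeft W (fun t => X t ω) (fun k => σ k ω) q).2 - q.2| ≤ K * t :=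
  MemoryJump.abs_firstLeft_sub_le hW hK (D.cadlag ω) (L.path ω hω) hj

/-- The mean of a function of the first jump is, up to a small multiple of `t`, its integral
against the jump density at the starting point. -/
theorem RegularDrivers.abs_integral_firstJump_sub_le [IsProbabilityMeasure P]
    (D : RegularDrivers P X σ U)
    (hW : Continuous W) (hK : ∀ x, |W x| ≤ K) (L : LocalControl W K X q t S δ ρ m) (hρ : 0 ≤ ρ)
    {h : ℝ → ℝ} (hh : Continuous h) {H : ℝ} (hH : ∀ x, |h x| ≤ H) :
    |(∫ ω, (jumpEvent W X σ q t).indicator (fun ω =>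
        h (jumpQuantile W (firstLeft W (fun t => X t ω) (fun k => σ k ω) q).1
          (firstLeft W (fun t => X t ω) (fun k => σ k ω) q).2 (U 0 ω))) ω ∂P) -
      t * ∫ x, h x * g W q.1 q.2 x| ≤
    H * (5 * (2 * Real.pi * ρ) * t + 5 * P.real (badEvent X σ S (4 * Real.pi * K * m * t)) +
      (4 * Real.pi * K * m * t) ^ 2) := by
  have hpi := Real.pi_pos
  have ht : (0 : ℝ) ≤ t := t.coe_nonneg
  have hH0 : 0 ≤ H := (abs_nonneg _).trans (hH 0)
  obtain ⟨hup, hlo⟩ := D.jumpEvent_prob hW hK L hρ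
  have hC := D.measurableSet_jumpEvent hW hK q t
  have hB := D.measurableSet_badEvent L.measurableSet (4 * Real.pi * K * m * t)
  have hsub := fun ω => D.jumpEvent_subset hW hK L (ω := ω)
  have hmean := D.integral_firstJump hW hK hh hH q t
  set ψ : Ω → ℝ := fun ω => ∫ v in Ioo (0 : ℝ) 1,
    h (jumpQuantile W (firstLeft W (fun t => X t ω) (fun k => σ k ω) q).1
      (firstLeft W (fun t => X t ω) (fun k => σ k ω) q).2 v) with hψ
  have hψm : Measurable ψ := (measurable_average hW hh).comp
    (measurable_firstLeft hW hK D.measurable_X D.cadlag D.measurable_σ q)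
  have hψb : ∀ ω, |ψ ω| ≤ H := fun ω => abs_average_le hH _ _
  set Ψ : ℝ := ∫ x, h x * g W q.1 q.2 x with hΨ
  have hΨb : |Ψ| ≤ H * gNorm W q.1 q.2 := abs_integral_mul_g_le hW hH _ _
  -- Only G·ψ is compared with Ψ, not ψ alone. With G' the norm at the state before the jump, G'·ψ
  -- is the integral of h against the unnormalised density there, hence close to Ψ, and G' is close
  -- to G.
  have hclose : ∀ ω, (fun t => X t ω) ∈ S → ω ∈ jumpEvent W X σ q t →
      |gNorm W q.1 q.2 * ψ ω - Ψ| ≤ 2 * H * (2 * Real.pi * ρ) := by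
    intro ω hω hj
    obtain ⟨hy, hs⟩ := D.abs_firstLeft_sub_le hW hK L hω hj
    have h1 := L.abs_gNorm_sub_le hW hy hs
    have h2 := abs_integral_mul_g_sub_le hW hh hH (L.density _ _ hy hs)
    rw [← integral_jumpQuantile_mul_gNorm hW hh] at h2
    set G' := gNorm W (firstLeft W (fun t => X t ω) (fun k => σ k ω) q).1
      (firstLeft W (fun t => X t ω) (fun k => σ k ω) q).2
    have h3 : |ψ ω * (G' - gNorm W q.1 q.2)| ≤ H * (2 * Real.pi * ρ) := by
      rw [abs_mul]
      exact mul_le_mul (hψb ω) h1 (abs_nonneg _) hH0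
    have h4 := abs_sub (ψ ω * G' - Ψ) (ψ ω * (G' - gNorm W q.1 q.2))
    have h5 : ψ ω * G' - Ψ - ψ ω * (G' - gNorm W q.1 q.2) = gNorm W q.1 q.2 * ψ ω - Ψ := by ring
    rw [h5] at h4
    linarith [h2, h3, h4]
  have hfar : ∀ ω, |gNorm W q.1 q.2 * ψ ω - Ψ| ≤ 2 * H * gNorm W q.1 q.2 := by
    intro ω
    have h1 : |gNorm W q.1 q.2 * ψ ω| ≤ gNorm W q.1 q.2 * H := by
      rw [abs_mul, abs_of_nonneg (gNorm_nonneg _ _)]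
      exact mul_le_mul_of_nonneg_left (hψb ω) (gNorm_nonneg _ _)
    linarith [abs_sub (gNorm W q.1 q.2 * ψ ω) Ψ]
  have hG := gNorm_nonneg (W := W) q.1 q.2
  have hε : 0 ≤ 2 * Real.pi * ρ := by positivity
  have hI : ∫ ω, (jumpEvent W X σ q t).indicator (fun ω =>
        h (jumpQuantile W (firstLeft W (fun t => X t ω) (fun k => σ k ω) q).1
          (firstLeft W (fun t => X t ω) (fun k => σ k ω) q).2 (U 0 ω))) ω ∂P =
      ∫ ω, (jumpEvent W X σ q t).indicator ψ ω ∂P := hmean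
  rw [hI]
  have hψi : Integrable ψ P :=
    Integrable.of_bound hψm.aestronglyMeasurable H (Eventually.of_forall hψb)
  have hIb : |∫ ω, (jumpEvent W X σ q t).indicator ψ ω ∂P| ≤ H * P.real (jumpEvent W X σ q t) := by
    rw [integral_indicator hC]
    exact norm_setIntegral_le_of_norm_le_const (f := ψ) (measure_lt_top _ _) fun ω _ => hψb ω
  have hdiff : |gNorm W q.1 q.2 * (∫ ω, (jumpEvent W X σ q t).indicator ψ ω ∂P) -
      Ψ * P.real (jumpEvent W X σ q t)| ≤
      2 * H * (2 * Real.pi * ρ) * P.real (jumpEvent W X σ q t) +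
        2 * H * gNorm W q.1 q.2 * P.real (badEvent X σ S (4 * Real.pi * K * m * t)) := by
    have h1 : gNorm W q.1 q.2 * (∫ ω, (jumpEvent W X σ q t).indicator ψ ω ∂P) -
        Ψ * P.real (jumpEvent W X σ q t) =
        ∫ ω, (jumpEvent W X σ q t).indicator (fun ω => gNorm W q.1 q.2 * ψ ω - Ψ) ω ∂P := by
      rw [integral_indicator hC, integral_indicator hC,
        integral_sub (hψi.const_mul _).integrableOn (integrable_const _).integrableOn,
        integral_const_mul, setIntegral_const, smul_eq_mul, mul_comm Ψ]
    have h2 : 2 * H * (2 * Real.pi * ρ) * P.real (jumpEvent W X σ q t) +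
        2 * H * gNorm W q.1 q.2 * P.real (badEvent X σ S (4 * Real.pi * K * m * t)) =
        ∫ ω, ((jumpEvent W X σ q t).indicator (fun _ => 2 * H * (2 * Real.pi * ρ)) ω +
          (badEvent X σ S (4 * Real.pi * K * m * t)).indicator
            (fun _ => 2 * H * gNorm W q.1 q.2) ω) ∂P := by
      rw [integral_add ((integrable_const _).indicator hC) ((integrable_const _).indicator hB),
        integral_indicator_const _ hC, integral_indicator_const _ hB, smul_eq_mul, smul_eq_mul]
      ring
    rw [h1, h2, ← Real.norm_eq_abs]
    refine norm_integral_le_of_norm_le (((integrable_const _).indicator hC).add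
      ((integrable_const _).indicator hB)) (Eventually.of_forall fun ω => ?_)
    have hn1 : 0 ≤ (badEvent X σ S (4 * Real.pi * K * m * t)).indicator
        (fun _ => 2 * H * gNorm W q.1 q.2) ω := indicator_nonneg (fun _ _ => by positivity) ω
    have hn2 : 0 ≤ 2 * H * (2 * Real.pi * ρ) := by positivity
    by_cases hj : ω ∈ jumpEvent W X σ q t
    · rw [indicator_of_mem hj, indicator_of_mem hj, Real.norm_eq_abs]
      by_cases hS : (fun t => X t ω) ∈ S
      · linarith [hclose ω hS hj]
      · have hb : ω ∈ badEvent X σ S (4 * Real.pi * K * m * t) := ⟨hS, hsub ω hj⟩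
        rw [indicator_of_mem hb]
        linarith [hfar ω]
    · rw [indicator_of_notMem hj, indicator_of_notMem hj, norm_zero]
      linarith
  set I := ∫ ω, (jumpEvent W X σ q t).indicator ψ ω ∂P
  set c := P.real (jumpEvent W X σ q t)
  set β := P.real (badEvent X σ S (4 * Real.pi * K * m * t))
  have hβ : 0 ≤ β := measureReal_nonneg
  set G := gNorm W q.1 q.2
  set ε := 2 * Real.pi * ρ
  set l := (4 * Real.pi * K * m * t) ^ 2
  have hl : 0 ≤ l := sq_nonneg _
  -- If G ≤ ε, both the mean and tΨ are already within the error bound. Otherwise the inequality is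
  -- proved after multiplication by G: each error term then carries a factor G, using ε ≤ G where it
  -- is missing, and G is cancelled.
  rcases le_or_gt G ε with hGε | hGε
  · have h1 : |t * Ψ| ≤ t * (H * ε) := by
      rw [abs_mul, abs_of_nonneg ht]
      gcongr
      exact hΨb.trans (by gcongr)
    have h2 : H * c ≤ H * (2 * ε * t + β) := by
      gcongr
      refine hup.trans ?_
      have : (G + ε) * t ≤ 2 * ε * t := by gcongr; linarith
      linarith
    have h3 := abs_sub I (t * Ψ)
    have h4 : 0 ≤ H * (ε * t) := by positivity
    have h5 : 0 ≤ H * β := by positivity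
    have h6 : 0 ≤ H * l := by positivity
    nlinarith
  · have hG0 : 0 < G := hε.trans_lt hGε
    refine le_of_mul_le_mul_left ?_ hG0
    have h1 : |c - G * t| ≤ ε * t + l + β := by
      rw [abs_le]
      constructor
      · linarith
      · nlinarith
    have h2 : ε * c ≤ 2 * G * ε * t + G * β := by
      have e1 : ε * c ≤ ε * ((G + ε) * t + β) := by gcongr
      have e2 : ε * (ε * t) ≤ G * (ε * t) := by gcongr
      have e3 : ε * β ≤ G * β := by gcongr
      nlinarith
    have h3 : |Ψ * (c - G * t)| ≤ H * G * (ε * t + l + β) := by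
      rw [abs_mul]
      gcongr
    have h4 : G * |I - t * Ψ| = |(G * I - Ψ * c) + Ψ * (c - G * t)| := by
      rw [← abs_of_nonneg hG, ← abs_mul, abs_of_nonneg hG]
      congr 1
      ring
    rw [h4]
    have h5 := abs_add_le (G * I - Ψ * c) (Ψ * (c - G * t))
    have h6 : 2 * H * ε * c ≤ 2 * H * (2 * G * ε * t + G * β) := by
      have := mul_le_mul_of_nonneg_left h2 (by positivity : 0 ≤ 2 * H)
      linarith
    have h7 : 0 ≤ H * G * β := by positivity
    calc _ ≤ 2 * H * ε * c + 2 * H * G * β + H * G * (ε * t + l + β) := by linarith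
      _ ≤ 2 * H * (2 * G * ε * t + G * β) + 2 * H * G * β + H * G * (ε * t + l + β) := by linarith
      _ = G * (H * (5 * ε * t + 5 * β + l)) := by ring

end Estimate

/-! ### Comparison of the two processes at a fixed starting point -/

section Comparison

variable {Ω : Type*} {mΩ : MeasurableSpace Ω} {P : Measure Ω} {W : ℝ → ℝ} {K : ℝ}
  {X : ℝ≥0 → Ω → ℝ} {σ : ℕ → Ω → ℝ≥0} {U : ℕ → Ω → ℝ}
  {q : ℝ × ℝ} {t : ℝ≥0} {S : Set (ℝ≥0 → ℝ)} {δ ρ m : ℝ}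

theorem jumpOp_eq (f : ℝ × ℝ → ℝ) (q : ℝ × ℝ) :
    jumpOp W f q = ∫ x, (f (q.1 + x, q.2) - f q) * g W q.1 q.2 x := by
  rw [integral_mul_g, jumpOp]
  have := intervalIntegral.integral_comp_add_left
    (f := fun x => (f (x, q.2) - f q) * max ((W q.1 - W x) * q.2) 0)
    (a := -Real.pi) (b := Real.pi) q.1
  rw [this, add_comm q.1, add_comm q.1]

/-- The two processes differ, up to events of small probability, by the first jump only. -/
theorem RegularDrivers.abs_integral_path_sub_le [IsProbabilityMeasure P]
    (D : RegularDrivers P X σ U)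
    (hW : Continuous W) (hK : ∀ x, |W x| ≤ K) (L : LocalControl W K X q t S δ ρ m)
    {f : ℝ × ℝ → ℝ} (hf : Continuous f) {F : ℝ} (hF : ∀ z, |f z| ≤ F) {w : ℝ} (hw0 : 0 ≤ w)
    (hw : ∀ a b : ℝ × ℝ, |a.1 - b.1| ≤ δ → |a.2 - b.2| ≤ K * t → |f a - f b| ≤ w) :
    |(∫ ω, (f (pathYS W (fun t => X t ω) (fun k => σ k ω) (fun n => U n ω) q t) -
        f (pathHat W (fun t => X t ω) q t)) ∂P) -
      ∫ ω, (jumpEvent W X σ q t).indicator (fun ω =>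
        f (q.1 + jumpQuantile W (firstLeft W (fun t => X t ω) (fun k => σ k ω) q).1
          (firstLeft W (fun t => X t ω) (fun k => σ k ω) q).2 (U 0 ω), q.2) - f q) ω ∂P| ≤
    4 * F * P.real {ω | (σ 2 ω : ℝ) ≤ 4 * Real.pi * K * m * t} +
      4 * F * P.real (badEvent X σ S (4 * Real.pi * K * m * t)) +
      2 * w * P.real {ω | (σ 1 ω : ℝ) ≤ 4 * Real.pi * K * m * t} := by
  have hF0 : 0 ≤ F := (abs_nonneg _).trans (hF 0)
  have hC := D.measurableSet_jumpEvent hW hK q t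
  have hB := D.measurableSet_badEvent L.measurableSet (4 * Real.pi * K * m * t)
  have h2 := D.measurableSet_le_σ 2 (4 * Real.pi * K * m * t)
  have h1 := D.measurableSet_le_σ 1 (4 * Real.pi * K * m * t)
  have hLm := measurable_firstLeft hW hK D.measurable_X D.cadlag D.measurable_σ q
  have hQm : Measurable (fun ω => jumpQuantile W
      (firstLeft W (fun t => X t ω) (fun k => σ k ω) q).1
      (firstLeft W (fun t => X t ω) (fun k => σ k ω) q).2 (U 0 ω)) :=
    measurable_jumpQuantile hW hLm.fst hLm.snd (D.measurable_U 0) (D.U_mem 0)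
  have hd : ∀ a b, |f a - f b| ≤ 2 * F := fun a b => by
    linarith [abs_sub (f a) (f b), hF a, hF b]
  have hiD : Integrable (fun ω => f (pathYS W (fun t => X t ω) (fun k => σ k ω)
      (fun n => U n ω) q t) - f (pathHat W (fun t => X t ω) q t)) P := by
    refine Integrable.of_bound (Measurable.aestronglyMeasurable ?_) (2 * F)
      (Eventually.of_forall fun ω => hd _ _)
    exact (hf.measurable.comp (measurable_pathYS hW hK D.measurable_X D.cadlag D.measurable_σ
      D.measurable_U D.U_mem q t)).sub
      (hf.measurable.comp (measurable_pathHat hW D.measurable_X D.cadlag q t))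
  have hiZ : Integrable ((jumpEvent W X σ q t).indicator (fun ω =>
      f (q.1 + jumpQuantile W (firstLeft W (fun t => X t ω) (fun k => σ k ω) q).1
        (firstLeft W (fun t => X t ω) (fun k => σ k ω) q).2 (U 0 ω), q.2) - f q)) P := by
    refine Integrable.indicator (Integrable.of_bound (Measurable.aestronglyMeasurable ?_) (2 * F)
      (Eventually.of_forall fun ω => hd _ _)) hC
    exact (hf.measurable.comp ((hQm.const_add q.1).prodMk measurable_const)).sub_const _
  have hbound : 4 * F * P.real {ω | (σ 2 ω : ℝ) ≤ 4 * Real.pi * K * m * t} +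
      4 * F * P.real (badEvent X σ S (4 * Real.pi * K * m * t)) +
      2 * w * P.real {ω | (σ 1 ω : ℝ) ≤ 4 * Real.pi * K * m * t} =
      ∫ ω, ({ω | (σ 2 ω : ℝ) ≤ 4 * Real.pi * K * m * t}.indicator (fun _ => 4 * F) ω +
        (badEvent X σ S (4 * Real.pi * K * m * t)).indicator (fun _ => 4 * F) ω +
        {ω | (σ 1 ω : ℝ) ≤ 4 * Real.pi * K * m * t}.indicator (fun _ => 2 * w) ω) ∂P := by
    rw [integral_add (((integrable_const _).indicator h2).add ((integrable_const _).indicator hB))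
      ((integrable_const _).indicator h1),
      integral_add ((integrable_const _).indicator h2) ((integrable_const _).indicator hB),
      integral_indicator_const _ h2, integral_indicator_const _ hB, integral_indicator_const _ h1,
      smul_eq_mul, smul_eq_mul, smul_eq_mul]
    ring
  rw [hbound, ← integral_sub hiD hiZ, ← Real.norm_eq_abs]
  refine norm_integral_le_of_norm_le ((((integrable_const _).indicator h2).add
    ((integrable_const _).indicator hB)).add ((integrable_const _).indicator h1))
    (Eventually.of_forall fun ω => ?_)
  have n2 : 0 ≤ {ω | (σ 2 ω : ℝ) ≤ 4 * Real.pi * K * m * t}.indicator (fun _ => 4 * F) ω :=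
    indicator_nonneg (fun _ _ => by positivity) ω
  have nB : 0 ≤ (badEvent X σ S (4 * Real.pi * K * m * t)).indicator (fun _ => 4 * F) ω :=
    indicator_nonneg (fun _ _ => by positivity) ω
  have n1 : 0 ≤ {ω | (σ 1 ω : ℝ) ≤ 4 * Real.pi * K * m * t}.indicator (fun _ => 2 * w) ω :=
    indicator_nonneg (fun _ _ => by positivity) ω
  by_cases hj : ω ∈ jumpEvent W X σ q t
  · have hσ1 := D.jumpEvent_subset hW hK L hj
    rw [indicator_of_mem hj, Real.norm_eq_abs]
    set η := jumpQuantile W (firstLeft W (fun t => X t ω) (fun k => σ k ω) q).1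
      (firstLeft W (fun t => X t ω) (fun k => σ k ω) q).2 (U 0 ω) with hη
    set a := pathYS W (fun t => X t ω) (fun k => σ k ω) (fun n => U n ω) q t with ha
    set b := pathHat W (fun t => X t ω) q t with hb
    -- The crude bound serves on the two rare events, a second jump or a bad path. With exactly one
    -- jump and |X_t| ≤ δ, `a` is near (y + η, s) and `b` near (y, s), which gives 2w.
    have hall : |f a - f b - (f (q.1 + η, q.2) - f q)| ≤ 4 * F := by
      linarith [abs_sub (f a - f b) (f (q.1 + η, q.2) - f q), hd a b, hd (q.1 + η, q.2) q]
    by_cases hτ2 : (stage W (fun t => X t ω) (fun k => σ k ω) (fun n => U n ω) q.1 q.2 2).time ≤ t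
    · have hσ2 := le_of_second_jump hW hK (D.cadlag ω) (D.σ_zero ω) L.memory hτ2
      have hmem : ω ∈ {ω | (σ 2 ω : ℝ) ≤ 4 * Real.pi * K * m * t} := hσ2
      rw [indicator_of_mem hmem] at n2 ⊢
      linarith
    · by_cases hS : (fun t => X t ω) ∈ S
      · have hmem : ω ∈ {ω | (σ 1 ω : ℝ) ≤ 4 * Real.pi * K * m * t} := hσ1
        rw [indicator_of_mem hmem] at n1 ⊢
        have hXt := L.path ω hS t le_rfl
        have e1 : |f a - f (q.1 + η, q.2)| ≤ w := by
          refine hw _ _ ?_ (abs_pathYS_snd_sub_le hW hK (D.cadlag ω) q t)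
          have hτ1 : (stage W (fun t => X t ω) (fun k => σ k ω) (fun n => U n ω) q.1 q.2 1).time
              ≤ t := hj
          have : a.1 = q.1 + X t ω + η :=
            (pathYS_fst_of_one_jump hτ1 (not_le.1 hτ2)).trans (by rw [stage_one_jumps])
          rw [this]
          simpa [add_right_comm] using hXt
        have e2 : |f b - f q| ≤ w := by
          refine hw _ _ ?_ (abs_pathHat_snd_sub_le hK q t)
          simpa [hb, pathHat] using hXt
        have e3 := abs_sub (f a - f (q.1 + η, q.2)) (f b - f q)
        have e4 : f a - f (q.1 + η, q.2) - (f b - f q) = f a - f b - (f (q.1 + η, q.2) - f q) := by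
          ring
        rw [e4] at e3
        linarith
      · have hbad : ω ∈ badEvent X σ S (4 * Real.pi * K * m * t) := ⟨hS, hσ1⟩
        rw [indicator_of_mem hbad] at nB ⊢
        linarith
  · have hlt : (t : ℝ≥0∞) < (stage W (fun t => X t ω) (fun k => σ k ω) (fun n => U n ω)
        q.1 q.2 1).time := not_le.1 hj
    rw [indicator_of_notMem hj, pathYS_eq_pathHat hlt, sub_self, sub_zero, norm_zero]
    linarith

/-- The quantitative comparison of the two semigroups at a point. -/
theorem RegularDrivers.abs_semigroup_sub_le [IsProbabilityMeasure P] (D : RegularDrivers P X σ U)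
    (hW : Continuous W) (hK : ∀ x, |W x| ≤ K) (L : LocalControl W K X q t S δ ρ m) (hρ : 0 ≤ ρ)
    {f : ℝ × ℝ → ℝ} (hf : Continuous f) {F : ℝ} (hF : ∀ z, |f z| ≤ F) {w : ℝ} (hw0 : 0 ≤ w)
    (hw : ∀ a b : ℝ × ℝ, |a.1 - b.1| ≤ δ → |a.2 - b.2| ≤ K * t → |f a - f b| ≤ w) :
    |(∫ ω, f (pathYS W (fun t => X t ω) (fun k => σ k ω) (fun n => U n ω) q t) ∂P) -
        (∫ ω, f (pathHat W (fun t => X t ω) q t) ∂P) - t * jumpOp W f q| ≤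
    t * (6 * F * (4 * Real.pi * K * m) ^ 2 * t +
      14 * F * (4 * Real.pi * K * m) * P.real {ω | (fun t => X t ω) ∉ S} +
      2 * w * (4 * Real.pi * K * m) + 20 * Real.pi * F * ρ) := by
  have hF0 : 0 ≤ F := (abs_nonneg _).trans (hF 0)
  have hK0 : 0 ≤ K := (abs_nonneg (W 0)).trans (hK 0)
  have hpi := Real.pi_pos
  have ht : (0 : ℝ) ≤ t := t.coe_nonneg
  have hm0 : 0 ≤ m := le_trans (by positivity) L.memory
  have hΛ : 0 ≤ 4 * Real.pi * K * m * t := by positivity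
  have hi1 : Integrable (fun ω => f (pathYS W (fun t => X t ω) (fun k => σ k ω)
      (fun n => U n ω) q t)) P :=
    Integrable.of_bound (hf.measurable.comp (measurable_pathYS hW hK D.measurable_X D.cadlag
      D.measurable_σ D.measurable_U D.U_mem q t)).aestronglyMeasurable F
      (Eventually.of_forall fun ω => hF _)
  have hi2 : Integrable (fun ω => f (pathHat W (fun t => X t ω) q t)) P :=
    Integrable.of_bound (hf.measurable.comp (measurable_pathHat hW D.measurable_X D.cadlag
      q t)).aestronglyMeasurable F (Eventually.of_forall fun ω => hF _)
  have hA := D.abs_integral_path_sub_le hW hK L hf hF hw0 hw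
  have hh : Continuous (fun x => f (q.1 + x, q.2) - f q) := by fun_prop
  have hE := D.abs_integral_firstJump_sub_le hW hK L hρ hh (H := 2 * F) fun x => by
    linarith [abs_sub (f (q.1 + x, q.2)) (f q), hF (q.1 + x, q.2), hF q]
  rw [integral_sub hi1 hi2] at hA
  rw [← jumpOp_eq] at hE
  have hβ := D.badEvent_le L.measurableSet hΛ
  have h2 := D.second_le _ hΛ
  have h1 := D.first_le _ hΛ
  have hβ' := mul_le_mul_of_nonneg_left hβ (by positivity : 0 ≤ 14 * F)
  have h2' := mul_le_mul_of_nonneg_left h2 (by positivity : 0 ≤ 4 * F)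
  have h1' := mul_le_mul_of_nonneg_left h1 (by positivity : 0 ≤ 2 * w)
  -- The increment of f is bounded by 2F, whence 6 = 4 + 2, 14 = 4 + 2·5 and 20π = 2·5·2π.
  refine (abs_sub_le _ _ _).trans ((add_le_add hA hE).trans ?_)
  linear_combination hβ' + h2' + h1'

end Comparison

/-! ### Uniformity in the starting point -/

section Uniform

variable {Ω : Type*} {mΩ : MeasurableSpace Ω} {P : Measure Ω} {W : ℝ → ℝ} {K : ℝ}
  {X : ℝ≥0 → Ω → ℝ} {σ : ℕ → Ω → ℝ≥0} {U : ℕ → Ω → ℝ}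

theorem exists_pos_mul_le {A e : ℝ} (hA : 0 ≤ A) (he : 0 < e) : ∃ c > 0, A * c ≤ e := by
  refine ⟨e / (A + 1), by positivity, ?_⟩
  rw [mul_div_assoc', div_le_iff₀ (by positivity)]
  nlinarith

theorem eventually_mul_le (A : ℝ) {e : ℝ} (he : 0 < e) : ∀ᶠ t : ℝ≥0 in 𝓝[>] 0, A * t ≤ e := by
  have h : Tendsto (fun t : ℝ≥0 => A * (t : ℝ)) (𝓝 0) (𝓝 (A * ((0 : ℝ≥0) : ℝ))) :=
    (continuous_const.mul NNReal.continuous_coe).tendsto 0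
  rw [NNReal.coe_zero, mul_zero] at h
  exact (h.mono_left nhdsWithin_le_nhds).eventually_le_const he

theorem jumpOp_eq_zero {f : ℝ × ℝ → ℝ} {q : ℝ × ℝ} (h : ∀ x, f (x, q.2) = 0) :
    jumpOp W f q = 0 := by
  simp [jumpOp, h]

/-- The difference quotients of the two semigroups differ by `jumpOp` in the limit, uniformly. -/
theorem RegularDrivers.tendstoUniformly [IsProbabilityMeasure P] (D : RegularDrivers P X σ U)
    (hW : UniformContinuous W) (hK : ∀ x, |W x| ≤ K) {f : ℝ × ℝ → ℝ} (hf : IsCStar f) :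
    TendstoUniformly (fun (t : ℝ≥0) q =>
      ((∫ ω, f (pathYS W (fun t => X t ω) (fun k => σ k ω) (fun n => U n ω) q t) ∂P) -
        ∫ ω, f (pathHat W (fun t => X t ω) q t) ∂P) / (t : ℝ)) (jumpOp W f) (𝓝[>] 0) := by
  obtain ⟨F, hF⟩ := hf.bounded
  obtain ⟨M, hM, hsupp⟩ := hf.support
  have hF0 : 0 ≤ F := (abs_nonneg _).trans (hF 0)
  have hK0 : 0 ≤ K := (abs_nonneg (W 0)).trans (hK 0)
  have hpi := Real.pi_pos
  have hzero : ∀ z : ℝ × ℝ, M < |z.2| → f z = 0 := fun z hz => by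
    by_contra h
    exact absurd (hsupp h) (not_le.2 hz)
  -- Relevant starting points have |s| ≤ M + K, and up to time 1 the memory moves by at most another
  -- K.
  set m := M + 2 * K with hm
  have hm0 : 0 ≤ m := by positivity
  set Λ := 4 * Real.pi * K * m with hΛ
  have hΛ0 : 0 ≤ Λ := by positivity
  rw [Metric.tendstoUniformly_iff]
  intro e he
  have he8 : 0 < e / 8 := by positivity
  -- Each of the four error terms gets e/8: ρ for the density, w for the modulus of f, b for the
  -- paths leaving the δ-ball, and small t for the quadratic term. Half of ρ pays for the
  -- oscillation of W, the other half for the motion of S.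
  obtain ⟨ρ, hρ0, hρ⟩ := exists_pos_mul_le (A := 20 * Real.pi * F) (by positivity) he8
  obtain ⟨w, hw0, hw⟩ := exists_pos_mul_le (A := 2 * Λ) (by positivity) he8
  obtain ⟨b, hb0, hb⟩ := exists_pos_mul_le (A := 14 * F * Λ) (by positivity) he8
  obtain ⟨ρ₁, hρ₁0, hρ₁⟩ := exists_pos_mul_le (A := 2 * m) (by positivity) (half_pos hρ0)
  obtain ⟨δ₁, hδ₁0, hδ₁⟩ := Metric.uniformContinuous_iff.1 hf.uniformContinuous w hw0
  obtain ⟨δ₂, hδ₂0, hδ₂⟩ := Metric.uniformContinuous_iff.1 hW ρ₁ hρ₁0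
  set δ := min δ₁ δ₂ / 2 with hδ
  have hmin : 0 < min δ₁ δ₂ := lt_min hδ₁0 hδ₂0
  have hδ0 : 0 < δ := half_pos hmin
  have hδlt1 : δ < δ₁ := (half_lt_self hmin).trans_le (min_le_left _ _)
  have hδlt2 : δ < δ₂ := (half_lt_self hmin).trans_le (min_le_right _ _)
  -- X does not involve the starting point, so `t₀` and `S` serve all `q` at once.
  obtain ⟨t₀, S, ht₀, hSm, hSb, hSpath⟩ := D.exists_small_path hδ0 hb0
  filter_upwards [self_mem_nhdsWithin, nhdsWithin_le_nhds (Iio_mem_nhds ht₀),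
    eventually_mul_le 1 one_pos, eventually_mul_le K hδ0,
    eventually_mul_le (2 * K * K) (half_pos hρ0), eventually_mul_le (6 * F * Λ ^ 2) he8]
    with t ht htt₀ ht1 htK htρ htF q
  have htpos : (0 : ℝ) < t := NNReal.coe_pos.2 ht
  have htlt : t < t₀ := htt₀
  rw [one_mul] at ht1
  -- From outside the enlarged strip the memory cannot reach the support of f by time t ≤ 1, so all
  -- three terms vanish.
  rcases lt_or_ge (M + K) |q.2| with hq | hq
  · have hz : ∀ z : ℝ × ℝ, |z.2 - q.2| ≤ K * t → f z = 0 := fun z hz => by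
      refine hzero z ?_
      have h1 : K * t ≤ K * 1 := by gcongr
      have h2 := abs_sub_abs_le_abs_sub q.2 z.2
      rw [abs_sub_comm] at h2
      linarith
    have h0 : jumpOp W f q = 0 := jumpOp_eq_zero fun x => hzero _ (by
      show M < |q.2|
      linarith)
    have h1 : ∀ ω, f (pathYS W (fun t => X t ω) (fun k => σ k ω) (fun n => U n ω) q t) = 0 :=
      fun ω => hz _ (abs_pathYS_snd_sub_le hW.continuous hK (D.cadlag ω) q t)
    have h2 : ∀ ω, f (pathHat W (fun t => X t ω) q t) = 0 :=
      fun ω => hz _ (abs_pathHat_snd_sub_le hK q t)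
    simpa [h0, h1, h2] using he
  · have L : LocalControl W K X q t S δ ρ m := by
      refine ⟨hSm, fun ω hω r hr => hSpath ω hω r (hr.trans_lt htlt), fun y' s' hy hs x => ?_, ?_⟩
      · have hqm : |q.2| ≤ m := by linarith
        refine (abs_max_sub_max_le (ρ := ρ₁) hK (fun x => ?_) hqm x).trans ?_
        · refine (hδ₂ ?_).le
          rw [Real.dist_eq, add_sub_add_right_eq_sub]
          exact hy.trans_lt hδlt2
        · have h1 : 2 * K * |s' - q.2| ≤ 2 * K * (K * t) := by gcongr
          linarith
      · have h1 : K * t ≤ K * 1 := by gcongr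
        linarith
    have hmod : ∀ a b : ℝ × ℝ, |a.1 - b.1| ≤ δ → |a.2 - b.2| ≤ K * t → |f a - f b| ≤ w := by
      intro a b h1 h2
      refine (hδ₁ ?_).le
      rw [Prod.dist_eq, Real.dist_eq, Real.dist_eq]
      exact max_lt (h1.trans_lt hδlt1) ((h2.trans htK).trans_lt hδlt1)
    have key := D.abs_semigroup_sub_le hW.continuous hK L hρ0.le hf.uniformContinuous.continuous hF
      hw0.le hmod
    set T := ∫ ω, f (pathYS W (fun t => X t ω) (fun k => σ k ω) (fun n => U n ω) q t) ∂P
    set T' := ∫ ω, f (pathHat W (fun t => X t ω) q t) ∂P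
    have hbb : 14 * F * Λ * P.real {ω | (fun t => X t ω) ∉ S} ≤ 14 * F * Λ * b := by gcongr
    have hsum : 6 * F * Λ ^ 2 * t + 14 * F * Λ * P.real {ω | (fun t => X t ω) ∉ S} +
        2 * w * Λ + 20 * Real.pi * F * ρ < e := by linarith
    have heq : jumpOp W f q - (T - T') / t = -((T - T' - t * jumpOp W f q) / t) := by
      field_simp
      ring
    rw [Real.dist_eq, heq, abs_neg, abs_div, abs_of_pos htpos, div_lt_iff₀ htpos, mul_comm e]
    exact key.trans_lt (mul_lt_mul_of_pos_left hsum htpos)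

end Uniform

/-! ### Jump times of the Poisson process -/

section Poisson

variable {Ω : Type*} [MeasurableSpace Ω] {P : Measure Ω}

/-- The jump times of a monotone path, computed from its values at countably many times. -/
def seqJumpTime (n : ℝ≥0 → ℕ) (k : ℕ) : ℝ≥0 :=
  (⨅ i, if k ≤ n (TopologicalSpace.denseSeq ℝ≥0 i) then
    (TopologicalSpace.denseSeq ℝ≥0 i : ℝ≥0∞) else ∞).toNNReal

theorem measurable_seqJumpTime : Measurable seqJumpTime := by
  refine measurable_pi_iff.2 fun k => (Measurable.iInf fun i => ?_).ennreal_toNNReal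
  exact Measurable.ite (measurableSet_le measurable_const (measurable_pi_apply _))
    measurable_const measurable_const

/-- Any time at which the level is reached has dense times shortly after it. This exhibits the jump
times as a measurable function of the Poisson path, so independence passes to them. If the level is
never reached, both sides take the default value 0. -/
theorem seqJumpTime_eq {n : ℝ≥0 → ℕ} {k : ℕ} (h : ∀ s t, s ≤ t → k ≤ n s → k ≤ n t) :
    seqJumpTime n k = jumpTime n k := by
  rcases Set.eq_empty_or_nonempty {t | k ≤ n t} with he | hne
  · have h0 : ∀ t, ¬ k ≤ n t := fun t ht => (he ▸ ht : t ∈ (∅ : Set ℝ≥0))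
    simp [seqJumpTime, jumpTime, h0]
  · have : (⨅ i, if k ≤ n (TopologicalSpace.denseSeq ℝ≥0 i) then
        (TopologicalSpace.denseSeq ℝ≥0 i : ℝ≥0∞) else ∞) = (jumpTime n k : ℝ≥0∞) := by
      refine le_antisymm (le_of_forall_gt fun c hc => ?_) (le_iInf fun i => ?_)
      · obtain ⟨c', hc', hcc'⟩ := ENNReal.lt_iff_exists_nnreal_btwn.1 hc
        obtain ⟨t, ht, htc⟩ := exists_lt_of_csInf_lt hne (ENNReal.coe_lt_coe.1 hc')
        obtain ⟨_, ⟨hd1, hd2⟩, i, rfl⟩ := (TopologicalSpace.denseRange_denseSeq ℝ≥0).inter_open_nonempty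
          _ isOpen_Ioo (nonempty_Ioo.2 htc)
        refine lt_of_le_of_lt (iInf_le _ i) ?_
        rw [if_pos (h _ _ hd1.le ht)]
        exact (ENNReal.coe_lt_coe.2 hd2).trans hcc'
      · split_ifs with hi
        · exact ENNReal.coe_le_coe.2 (csInf_le (OrderBot.bddBelow _) hi)
        · exact le_top
    rw [seqJumpTime, this, ENNReal.toNNReal_coe]

theorem jumpTime_zero (n : ℝ≥0 → ℕ) : jumpTime n 0 = 0 :=
  le_antisymm (csInf_le (OrderBot.bddBelow _) (zero_le : 0 ≤ n 0)) zero_le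

theorem seqJumpTime_zero (n : ℝ≥0 → ℕ) : seqJumpTime n 0 = 0 := by
  rw [seqJumpTime_eq fun _ _ _ _ => zero_le, jumpTime_zero]

/-- An integer-valued right-continuous path is constant just after `a`, so the infimum is attained.
Nonemptiness matters: a level never reached would have jump time 0. -/
theorem jumpTime_le_iff {n : ℝ≥0 → ℕ} (hmono : Monotone n) (hc : IsCadlag n) {k : ℕ}
    (hne : ∃ t, k ≤ n t) (a : ℝ≥0) : jumpTime n k ≤ a ↔ k ≤ n a := by
  refine ⟨fun h => ?_, fun h => csInf_le (OrderBot.bddBelow _) h⟩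
  have h1 : ∀ᶠ a' in 𝓝[>] a, n a' = n a := by
    have h := (hc a).1.tendsto.mono_left (nhdsWithin_mono _ Ioi_subset_Ici_self)
    rw [nhds_discrete] at h
    exact tendsto_pure.1 h
  obtain ⟨a', ha', haa'⟩ := (h1.and self_mem_nhdsWithin).exists
  obtain ⟨t, ht, hta⟩ := exists_lt_of_csInf_lt hne (h.trans_lt haa')
  rw [← ha']
  exact le_trans ht (hmono hta.le)

theorem IsPoissonProcess.map_eq {N : ℝ≥0 → Ω → ℕ} (hN : IsPoissonProcess N P) (t : ℝ≥0) :
    P.map (N t) = poissonMeasure t := by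
  rw [← tsub_zero t, ← hN.law_increment 0 t zero_le, tsub_zero]
  refine Measure.map_congr ?_
  filter_upwards [hN.start] with ω hω
  simp [hω]

theorem IsPoissonProcess.real_one_le {N : ℝ≥0 → Ω → ℕ} (hN : IsPoissonProcess N P) (t : ℝ≥0) :
    P.real {ω | 1 ≤ N t ω} = 1 - Real.exp (-t) := by
  have h : P.real {ω | 1 ≤ N t ω} = (poissonMeasure t).real (Ici 1) := by
    rw [← hN.map_eq, map_measureReal_apply (hN.measurable t) measurableSet_Ici]
    rfl
  have hs : (Ici 1 : Set ℕ) = {0}ᶜ := by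
    ext n
    simp [Nat.one_le_iff_ne_zero]
  rw [h, hs, probReal_compl_eq_one_sub (measurableSet_singleton 0), poissonMeasure_real_singleton]
  simp

theorem poissonMeasure_real_zero_one (t : ℝ≥0) :
    (poissonMeasure t).real {0, 1} = Real.exp (-t) * (1 + t) := by
  rw [← Set.singleton_union, measureReal_union (by simp) (measurableSet_singleton 1),
    poissonMeasure_real_singleton, poissonMeasure_real_singleton]
  simp
  ring

theorem IsPoissonProcess.real_two_le {N : ℝ≥0 → Ω → ℕ} (hN : IsPoissonProcess N P) (t : ℝ≥0) :
    P.real {ω | 2 ≤ N t ω} = 1 - Real.exp (-t) * (1 + t) := by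
  have h : P.real {ω | 2 ≤ N t ω} = (poissonMeasure t).real (Ici 2) := by
    rw [← hN.map_eq, map_measureReal_apply (hN.measurable t) measurableSet_Ici]
    rfl
  have hs : (Ici 2 : Set ℕ) = {0, 1}ᶜ := by
    ext n
    simp only [mem_Ici, mem_compl_iff, mem_insert_iff, mem_singleton_iff]
    omega
  rw [h, hs, probReal_compl_eq_one_sub (MeasurableSet.of_discrete), poissonMeasure_real_zero_one]

/-- Excludes the default value 0 for σ₁ and σ₂, the only jump times whose laws enter the estimates.
-/
theorem IsPoissonProcess.ae_exists_two_le [IsProbabilityMeasure P] {N : ℝ≥0 → Ω → ℕ}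
    (hN : IsPoissonProcess N P) : ∀ᵐ ω ∂P, ∃ t, 2 ≤ N t ω := by
  have hlim : Tendsto (fun n : ℕ => P.real {ω | 2 ≤ N n ω}) atTop (𝓝 1) := by
    have h1 := (Real.tendsto_pow_mul_exp_neg_atTop_nhds_zero 0).comp tendsto_natCast_atTop_atTop
    have h2 := (Real.tendsto_pow_mul_exp_neg_atTop_nhds_zero 1).comp tendsto_natCast_atTop_atTop
    have h3 := (h1.add h2).const_sub (1 : ℝ)
    simp only [add_zero, sub_zero] at h3
    refine h3.congr fun n => ?_
    rw [hN.real_two_le]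
    simp
    ring
  have hm : MeasurableSet {ω | ∃ n : ℕ, 2 ≤ N n ω} := by
    have : {ω | ∃ n : ℕ, 2 ≤ N n ω} = ⋃ n : ℕ, {ω | 2 ≤ N n ω} := by ext; simp
    rw [this]
    exact MeasurableSet.iUnion fun n => measurableSet_le measurable_const (hN.measurable _)
  have h1 : 1 ≤ P.real {ω | ∃ n : ℕ, 2 ≤ N n ω} :=
    le_of_tendsto hlim (Eventually.of_forall fun n => measureReal_mono fun ω hω => ⟨n, hω⟩)
  have h2 : ∀ᵐ ω ∂P, ∃ n : ℕ, 2 ≤ N n ω := by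
    refine (mem_ae_iff_prob_eq_one hm).2 (le_antisymm prob_le_one ?_)
    rw [← ENNReal.ofReal_one]
    exact ENNReal.ofReal_le_of_le_toReal h1
  filter_upwards [h2] with ω ⟨n, hn⟩ using ⟨n, hn⟩

theorem exp_neg_le {a : ℝ} (ha : 0 ≤ a) : Real.exp (-a) ≤ 1 - a + a ^ 2 := by
  rw [Real.exp_neg, inv_le_comm₀ (Real.exp_pos a) (by nlinarith)]
  refine le_trans ?_ (Real.add_one_le_exp a)
  rw [inv_le_iff_one_le_mul₀ (by nlinarith)]
  -- (1 + a)(1 − a + a²) = 1 + a³ ≥ 1.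
  nlinarith [pow_nonneg ha 3]

theorem le_exp_neg_mul {a : ℝ} (ha : 0 ≤ a) : 1 - a ^ 2 ≤ Real.exp (-a) * (1 + a) := by
  have := Real.add_one_le_exp (-a)
  nlinarith

/-- Driving processes can be replaced by regular ones, outside of a null set. -/
theorem exists_regularDrivers [IsProbabilityMeasure P] {α : ℝ} {X : ℝ≥0 → Ω → ℝ}
    (hX : IsSymmetricStableProcess α X P) {N : ℝ≥0 → Ω → ℕ} (hN : IsPoissonProcess N P)
    {U : ℕ → Ω → ℝ} (hU : IsUniformSequence U P) (hindep : IndependentDrivers X N U P) :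
    ∃ (X' : ℝ≥0 → Ω → ℝ) (σ : ℕ → Ω → ℝ≥0) (U' : ℕ → Ω → ℝ), RegularDrivers P X' σ U' ∧
      ∀ᵐ ω ∂P, (fun t => X t ω) = (fun t => X' t ω) ∧
        jumpTime (fun t => N t ω) = (fun k => σ k ω) ∧ (fun n => U n ω) = fun n => U' n ω := by
  -- Off a measurable set of full measure the path of X is replaced by the zero path, and the
  -- uniform variables are clipped into (0,1).
  obtain ⟨G, hG, hGm, hGp⟩ := (hX.start.and hX.cadlag).exists_measurable_mem
  set X' : ℝ≥0 → Ω → ℝ := fun t => G.indicator (X t) with hX'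
  set σ : ℕ → Ω → ℝ≥0 := fun k ω => seqJumpTime (fun t => N t ω) k with hσ
  set U' : ℕ → Ω → ℝ := fun n ω => if U n ω ∈ Ioo (0 : ℝ) 1 then U n ω else 1 / 2 with hU'
  have hXX' : (fun ω t => X t ω) =ᵐ[P] fun ω t => X' t ω := by
    filter_upwards [hG] with ω hω
    funext t
    simp [hX', hω]
  have hNp : Measurable (fun ω t => N t ω) := measurable_pi_iff.2 hN.measurable
  have hUae : ∀ n, ∀ᵐ ω ∂P, U n ω ∈ Ioo (0 : ℝ) 1 := fun n => by
    refine ae_of_ae_map (hU.measurable n).aemeasurable ?_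
    rw [hU.law n]
    exact ae_restrict_mem measurableSet_Ioo
  have hσeq : ∀ᵐ ω ∂P, jumpTime (fun t => N t ω) = fun k => σ k ω := by
    filter_upwards [hN.monotone] with ω hω
    funext k
    exact (seqJumpTime_eq fun s t hst hk => hk.trans (hω hst)).symm
  have hσle : ∀ k, k ≤ 2 → ∀ a : ℝ, 0 ≤ a →
      P.real {ω | (σ k ω : ℝ) ≤ a} = P.real {ω | k ≤ N a.toNNReal ω} := by
    intro k hk a ha
    refine measureReal_congr ?_
    filter_upwards [hN.monotone, hN.cadlag, hN.ae_exists_two_le, hσeq] with ω hm hc ⟨t, ht⟩ hs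
    have h1 : σ k ω = jumpTime (fun t => N t ω) k := (congrFun hs k).symm
    have h2 := jumpTime_le_iff hm hc ⟨t, hk.trans ht⟩ a.toNNReal
    refine propext (Iff.trans ?_ h2)
    rw [← h1, Real.le_toNNReal_iff_coe_le ha]
    exact Iff.rfl
  refine ⟨X', σ, U', ⟨?_, ?_, ?_, ?_, ?_, ?_, ?_, ?_, ?_, ?_, ?_, ?_, ?_⟩, ?_⟩
  · exact fun t => (hX.measurable t).indicator hGm
  · intro ω
    by_cases hω : ω ∈ G
    · simpa [hX', hω] using (hGp ω hω).2
    · simp only [hX', indicator_of_notMem hω]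
      exact fun t => ⟨continuousWithinAt_const, 0, tendsto_const_nhds⟩
  · intro ω
    by_cases hω : ω ∈ G
    · simpa [hX', hω] using (hGp ω hω).1
    · simp [hX', hω]
  · exact fun k => (measurable_pi_apply k).comp (measurable_seqJumpTime.comp hNp)
  · exact fun ω => seqJumpTime_zero _
  · exact fun n => measurable_clip.comp (hU.measurable n)
  · exact fun n ω => clip_mem (U n ω)
  · rw [← hU.law 0]
    refine Measure.map_congr ?_
    filter_upwards [hUae 0] with ω hω
    simp only [hU', if_pos hω]
  · exact (hindep.1.comp measurable_id measurable_seqJumpTime).congr hXX' EventuallyEq.rfl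
  · have h := hindep.2.comp
      (φ := fun z : (ℝ≥0 → ℝ) × (ℝ≥0 → ℕ) => (z.1, seqJumpTime z.2))
      (ψ := fun u : ℕ → ℝ => if u 0 ∈ Ioo (0 : ℝ) 1 then u 0 else 1 / 2)
      (measurable_fst.prodMk (measurable_seqJumpTime.comp measurable_snd))
      (measurable_clip.comp (measurable_pi_apply 0))
    refine h.congr ?_ EventuallyEq.rfl
    filter_upwards [hXX'] with ω hω
    exact Prod.ext hω rfl
  · intro a ha
    rw [hσle 1 (by norm_num) a ha, hN.real_one_le, Real.coe_toNNReal a ha]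
    linarith [Real.add_one_le_exp (-a)]
  · intro a ha
    rw [hσle 1 (by norm_num) a ha, hN.real_one_le, Real.coe_toNNReal a ha]
    linarith [exp_neg_le ha]
  · intro a ha
    rw [hσle 2 le_rfl a ha, hN.real_two_le, Real.coe_toNNReal a ha]
    linarith [le_exp_neg_mul ha]
  · filter_upwards [hXX', hσeq, ae_all_iff.2 hUae] with ω h1 h2 h3
    refine ⟨h1, h2, funext fun n => ?_⟩
    simp only [hU', if_pos (h3 n)]

end Poisson

/-! ### The circle -/

section Circle

variable {V : Circle → ℝ}

theorem uniformContinuous_circleExp : UniformContinuous Circle.exp := by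
  refine LipschitzWith.uniformContinuous (K := 1) (LipschitzWith.of_dist_le_mul fun x y => ?_)
  have h := (lipschitzWith_circleMap 0 1).dist_le_mul x y
  simp only [circleMap, zero_add, Complex.ofReal_one, one_mul, map_one, ← Circle.coe_exp] at h
  exact h

/-- The covering map is open and surjective, hence a quotient map. -/
theorem continuous_of_continuous_lift (hV : Continuous (lift V)) : Continuous V :=
  (isLocalHomeomorph_circleExp.isOpenMap.isQuotientMap Circle.exp.continuous
    Circle.exp_surjective).continuous_iff.2 hV

theorem uniformContinuous_lift (hV : Continuous V) : UniformContinuous (lift V) :=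
  (CompactSpace.uniformContinuous_of_continuous hV).comp uniformContinuous_circleExp

theorem exists_bound_lift (hV : Continuous V) : ∃ K, ∀ x, |lift V x| ≤ K := by
  obtain ⟨K, hK⟩ := isCompact_univ.exists_bound_of_continuousOn hV.continuousOn
  exact ⟨K, fun x => hK _ (mem_univ _)⟩

theorem wrap_unwrap (p : Circle × ℝ) : wrap (unwrap p) = p :=
  Prod.ext (Circle.exp_arg p.1) rfl

theorem exists_strip {f : Circle × ℝ → ℝ} (hc : HasCompactSupport f) :
    ∃ M : ℝ, 0 < M ∧ ∀ p, M < |p.2| → f p = 0 := by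
  obtain ⟨M, hM⟩ := (hc.isCompact.image continuous_snd).isBounded.subset_closedBall 0
  refine ⟨max M 1, by positivity, fun p hp => ?_⟩
  by_contra h
  have h1 := hM ⟨p, subset_tsupport f h, rfl⟩
  rw [Metric.mem_closedBall, dist_zero_right, Real.norm_eq_abs] at h1
  exact absurd (h1.trans (le_max_left M 1)) (not_le.2 hp)

/-- This carries the problem on 𝕊 × ℝ back to the plane: C₀ functions are uniformly continuous,
`wrap` is too, and compact support gives a strip. -/
theorem isCStar_comp_wrap {f : C₀(Circle × ℝ, ℝ)} (hc : HasCompactSupport f) :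
    IsCStar (fun q => f (wrap q)) := by
  obtain ⟨M, hM, hz⟩ := exists_strip hc
  refine ⟨⟨‖f.toBCF‖, fun q => f.toBCF.norm_coe_le_norm (wrap q)⟩, ?_, M, hM, fun q hq => ?_⟩
  · have h : UniformContinuous wrap :=
      (uniformContinuous_circleExp.comp uniformContinuous_fst).prodMk uniformContinuous_snd
    exact (ZeroAtInftyContinuousMap.uniformContinuous f).comp h
  · by_contra h
    exact hq (hz _ (not_le.1 h))

/-- The integrand is 2π-periodic in the angle, so the window [−π, π] may be shifted to be centred at
Arg z. -/
theorem jumpOpCircle_eq (V : Circle → ℝ) (f : Circle × ℝ → ℝ) (p : Circle × ℝ) :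
    jumpOpCircle V f p = jumpOp (lift V) (fun q => f (wrap q)) (unwrap p) := by
  have hper : Function.Periodic (fun x : ℝ => (f (Circle.exp x, p.2) - f p) *
      max ((V p.1 - V (Circle.exp x)) * p.2) 0) (2 * Real.pi) := fun x => by
    simp only [Circle.exp_add_two_pi]
  have h := hper.intervalIntegral_add_eq (-Real.pi) (-Real.pi + (unwrap p).1)
  have e1 : -Real.pi + 2 * Real.pi = Real.pi := by ring
  have e2 : -Real.pi + (unwrap p).1 + 2 * Real.pi = Real.pi + (unwrap p).1 := by ring
  rw [e1, e2] at h
  have h1 : Circle.exp (unwrap p).1 = p.1 := Circle.exp_arg p.1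
  simp only [jumpOpCircle, arcIntegral, jumpOp, wrap_unwrap, lift, h1]
  exact h

/-- With compact support below, this keeps L ± R^𝕊 f in C₀, as membership in the domain of a
generator requires. -/
theorem continuous_jumpOpCircle (hV : Continuous V) {f : Circle × ℝ → ℝ} (hf : Continuous f) :
    Continuous (jumpOpCircle V f) := by
  refine intervalIntegral.continuous_parametric_intervalIntegral_of_continuous'
    (f := fun (p : Circle × ℝ) θ => (f (Circle.exp θ, p.2) - f p) *
      max ((V p.1 - V (Circle.exp θ)) * p.2) 0) ?_ _ _
  simp only [Function.uncurry_def]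
  fun_prop

theorem hasCompactSupport_jumpOpCircle {f : Circle × ℝ → ℝ} (hc : HasCompactSupport f) :
    HasCompactSupport (jumpOpCircle V f) := by
  obtain ⟨M, -, hz⟩ := exists_strip hc
  refine HasCompactSupport.intro (isCompact_univ.prod (isCompact_Icc (a := -M) (b := M)))
    fun p hp => ?_
  have hM : M < |p.2| := by
    by_contra h
    exact hp ⟨mem_univ _, abs_le.1 (not_lt.1 h)⟩
  have h0 : ∀ w, f (w, p.2) = 0 := fun w => hz _ hM
  simp [jumpOpCircle, arcIntegral, h0]

/-- `R^𝕊 f` as an element of `C₀`. -/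
def jumpOpCircleC0 (hV : Continuous V) (f : C₀(Circle × ℝ, ℝ)) (hc : HasCompactSupport f) :
    C₀(Circle × ℝ, ℝ) where
  toFun := jumpOpCircle V f
  continuous_toFun := continuous_jumpOpCircle hV f.continuous
  zero_at_infty' := (hasCompactSupport_jumpOpCircle hc).is_zero_at_infty

end Circle

/-! ### Comparison of the generators -/

section Generator

variable {Ω : Type*} [MeasurableSpace Ω] {P : Measure Ω}

theorem tendstoUniformly_semigroup_sub [IsProbabilityMeasure P] {α K : ℝ} {W : ℝ → ℝ}
    (hW : UniformContinuous W) (hK : ∀ x, |W x| ≤ K) {X : ℝ≥0 → Ω → ℝ}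
    (hX : IsSymmetricStableProcess α X P) {N : ℝ≥0 → Ω → ℕ} (hN : IsPoissonProcess N P)
    {U : ℕ → Ω → ℝ} (hU : IsUniformSequence U P) (hindep : IndependentDrivers X N U P)
    {f : ℝ × ℝ → ℝ} (hf : IsCStar f) :
    TendstoUniformly (fun (t : ℝ≥0) q =>
      (semigroupYS P W X N U t f q - semigroupHat P W X t f q) / (t : ℝ)) (jumpOp W f) (𝓝[>] 0) := by
  obtain ⟨X', σ, U', D, hae⟩ := exists_regularDrivers hX hN hU hindep
  have h1 : ∀ t q, semigroupYS P W X N U t f q =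
      ∫ ω, f (pathYS W (fun t => X' t ω) (fun k => σ k ω) (fun n => U' n ω) q t) ∂P := by
    intro t q
    refine integral_congr_ae ?_
    filter_upwards [hae] with ω hω
    simp only [processYS, hω.1, hω.2.1, hω.2.2]
  have h2 : ∀ t q, semigroupHat P W X t f q = ∫ ω, f (pathHat W (fun t => X' t ω) q t) ∂P := by
    intro t q
    refine integral_congr_ae ?_
    filter_upwards [hae] with ω hω
    simp only [processHat, hω.1]
  simp only [h1, h2]
  exact D.tendstoUniformly hW hK hf

variable {E : Type*} {T T' : ℝ≥0 → (E → ℝ) → E → ℝ} {f L R : E → ℝ}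

theorem IsGenLimit.add_of_tendstoUniformly (h : IsGenLimit T' f L)
    (hR : TendstoUniformly (fun (t : ℝ≥0) q => (T t f q - T' t f q) / (t : ℝ)) R (𝓝[>] 0)) :
    IsGenLimit T f (L + R) := by
  unfold IsGenLimit
  convert! TendstoUniformly.add h hR using 3
  simp only [Pi.add_apply]
  ring

theorem IsGenLimit.sub_of_tendstoUniformly (h : IsGenLimit T f L)
    (hR : TendstoUniformly (fun (t : ℝ≥0) q => (T t f q - T' t f q) / (t : ℝ)) R (𝓝[>] 0)) :
    IsGenLimit T' f (L - R) := by
  unfold IsGenLimit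
  convert! TendstoUniformly.sub h hR using 3
  simp only [Pi.sub_apply]
  ring

/-- Outside the strip the integrand vanishes; inside, the increment of f is at most 2B and the rate
at most 4πK|M|. The absolute value keeps the bound nonnegative when M is negative. -/
theorem abs_jumpOp_le {W : ℝ → ℝ} {K : ℝ} (hK : ∀ x, |W x| ≤ K) (hW : Continuous W) {M B : ℝ}
    {f : ℝ × ℝ → ℝ} (hsupp : Function.support f ⊆ {q | |q.2| ≤ M}) (hB : ∀ q, |f q| ≤ B)
    (q : ℝ × ℝ) : |jumpOp W f q| ≤ 8 * Real.pi * K * |M| * B := by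
  have hK0 : 0 ≤ K := (abs_nonneg (W 0)).trans (hK 0)
  have hB0 : 0 ≤ B := (abs_nonneg _).trans (hB 0)
  have hpi := Real.pi_pos
  rcases lt_or_ge M |q.2| with hq | hq
  · rw [jumpOp_eq_zero, abs_zero]
    · positivity
    · intro x
      by_contra h
      exact absurd (hsupp h) (not_le.2 hq)
  · rw [jumpOp_eq]
    refine (abs_integral_mul_g_le hW (H := 2 * B) (fun x => ?_) q.1 q.2).trans ?_
    · linarith [abs_sub (f (q.1 + x, q.2)) (f q), hB (q.1 + x, q.2), hB q]
    · have h1 : gNorm W q.1 q.2 ≤ 4 * Real.pi * K * |M| := by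
        refine (gNorm_le hK _ _).trans ?_
        have := hq.trans (le_abs_self M)
        gcongr
      calc 2 * B * gNorm W q.1 q.2 ≤ 2 * B * (4 * Real.pi * K * |M|) := by gcongr
        _ = _ := by ring

end Generator

end MemoryJump

end

/-! ### The theorem -/

open MemoryJump in
theorem proposition2 {Ω : Type*} [MeasurableSpace Ω] (P : Measure Ω) [IsProbabilityMeasure P]
    (α : ℝ) (hα : α ∈ Ioo (0 : ℝ) 2)
    (V : Circle → ℝ) (hV : ContDiff ℝ 3 (lift V)) (hV_mean : arcIntegral V = 0)
    (hV_const : ¬ ∃ c : ℝ, ∀ z, V z = c)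
    (X : ℝ≥0 → Ω → ℝ) (hX : IsSymmetricStableProcess α X P)
    (N : ℝ≥0 → Ω → ℕ) (hN : IsPoissonProcess N P)
    (U : ℕ → Ω → ℝ) (hU : IsUniformSequence U P)
    (hindep : IndependentDrivers X N U P) :
    -- the generator limits on `C_*(ℝ²)`
    (∀ f : ℝ × ℝ → ℝ, IsCStar f →
      ((∃ L : ℝ × ℝ → ℝ, IsGenLimit (semigroupYS P (lift V) X N U) f L) ↔
        ∃ L : ℝ × ℝ → ℝ, IsGenLimit (semigroupHat P (lift V) X) f L) ∧
      ∀ L L' : ℝ × ℝ → ℝ, IsGenLimit (semigroupYS P (lift V) X N U) f L →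
        IsGenLimit (semigroupHat P (lift V) X) f L' → L = L' + jumpOp (lift V) f) ∧
    -- the jump operator is bounded on functions supported in a fixed strip
    (∀ M : ℝ, ∃ C : ℝ, ∀ f : ℝ × ℝ → ℝ, IsCStar f →
      Function.support f ⊆ {q | |q.2| ≤ M} →
      ∀ B : ℝ, (∀ q, |f q| ≤ B) → ∀ q, |jumpOp (lift V) f q| ≤ C * B) ∧
    -- the generators of the processes on `𝕊 × ℝ`
    (genDomain (semigroupZS P (lift V) X N U) ∩ CcSet (Circle × ℝ) =
      genDomain (semigroupZHat P (lift V) X) ∩ CcSet (Circle × ℝ)) ∧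
    (∀ (f : C₀(Circle × ℝ, ℝ)) (hf : f ∈ genDomain (semigroupZS P (lift V) X N U))
      (hf' : f ∈ genDomain (semigroupZHat P (lift V) X)),
      f ∈ CcSet (Circle × ℝ) →
      ∀ p, generator _ f hf p = generator _ f hf' p + jumpOpCircle V f p) := by
  have hVc : Continuous V := continuous_of_continuous_lift hV.continuous
  have hW := uniformContinuous_lift hVc
  obtain ⟨K, hK⟩ := exists_bound_lift hVc
  have key : ∀ f : ℝ × ℝ → ℝ, IsCStar f → TendstoUniformly (fun (t : ℝ≥0) q =>
      (semigroupYS P (lift V) X N U t f q - semigroupHat P (lift V) X t f q) / (t : ℝ))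
      (jumpOp (lift V) f) (𝓝[>] 0) :=
    fun f hf => tendstoUniformly_semigroup_sub hW hK hX hN hU hindep hf
  have keyZ : ∀ f : C₀(Circle × ℝ, ℝ), HasCompactSupport f →
      TendstoUniformly (fun (t : ℝ≥0) p => (semigroupZS P (lift V) X N U t f p -
        semigroupZHat P (lift V) X t f p) / (t : ℝ)) (jumpOpCircle V f) (𝓝[>] 0) := by
    intro f hf
    -- The circle semigroups at p are by definition the plane ones applied to f ∘ `wrap` at `unwrap
    -- p`, and uniform convergence survives composition with `unwrap`.
    have h := (key _ (isCStar_comp_wrap hf)).comp unwrap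
    have hR : jumpOp (lift V) (fun q => f (wrap q)) ∘ unwrap = jumpOpCircle V f :=
      funext fun p => (jumpOpCircle_eq V f p).symm
    rw [hR] at h
    exact h
  refine ⟨fun f hf => ⟨⟨fun ⟨L, hL⟩ => ⟨_, hL.sub_of_tendstoUniformly (key f hf)⟩,
      fun ⟨L, hL⟩ => ⟨_, hL.add_of_tendstoUniformly (key f hf)⟩⟩,
      fun L L' hL hL' => hL.unique (hL'.add_of_tendstoUniformly (key f hf))⟩,
    fun M => ⟨8 * Real.pi * K * |M|,
      fun f _ hsupp B hB q => abs_jumpOp_le hK hW.continuous hsupp hB q⟩, ?_, ?_⟩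
  · ext f
    constructor
    · rintro ⟨⟨L, hL⟩, hc⟩
      exact ⟨⟨L - jumpOpCircleC0 hVc f hc, hL.sub_of_tendstoUniformly (keyZ f hc)⟩, hc⟩
    · rintro ⟨⟨L, hL⟩, hc⟩
      exact ⟨⟨L + jumpOpCircleC0 hVc f hc, hL.add_of_tendstoUniformly (keyZ f hc)⟩, hc⟩
  · intro f hf hf' hc p
    exact congrFun ((generator_spec hf).unique
      ((generator_spec hf').add_of_tendstoUniformly (keyZ f hc))) p
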